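/- A conditioned weighted graph is a triple $\mathcal{G}=(M,w^-,w^+)$, where $M$ is a real $N\times N$ matrix with non-negative entries, $N>1$, and $w^-,w^+:\{1,\dots,N\}\to[0,\infty)$ (seen as a row and a column vector respectively), such that: (i) $M$ has a unique complex eigenvalue $\lambda$ of maximal modulus, and it is simple (algebraic multiplicity one); (ii) if $\ell$ and $r$ are nonzero non-negative left and right $\lambda$-eigenvectors of $M$, then $w^-\cdot r>0$ and $\ell\cdot w^+>0$. For $k\ge 0$, let $G_k$ be the set of paths of length $k$, i.e. of sequences $z=(x_0,\dots,x_k)$ in $\{1,\dots,N\}$ with $M_{x_i,x_{i+1}}>0$ for all $0\le i<k$; let $w(z)=w^-(x_0)M_{x_0,x_1}\cdots M_{x_{k-1},x_k}w^+(x_k)$ and $Z_k=\sum_{z\in G_k}w(z)$, and, for $k$ large enough that $Z_k>0$, let $\mu_k$ be the probability distribution on $G_k$ given by $\mu_k(z)=w(z)/Z_k$. Let $\Omega$ be the compact space of all finite (non-empty) and infinite paths, into which every $G_k$ embeds; let $\mu$ be the weak limit on $\Omega$ of $(\mu_k)$. Under $\mu$ the successive vertices $(X_n)_{n\ge0}$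 form a Markov chain on $\{1,\dots,N\}$. Let $\pi$ be the stationary probability measure of this chain restricted to the states that it reaches with positive probability, extended by $0$ to $\{1,\dots,N\}$. Theorem. Let $\mathcal{G}=(M,w^-,w^+)$ be a conditioned weighted graph with $M$ of size $N\times N$, let $\mu$ and $\pi$ be as above, let $f:\{1,\dots,N\}\to\mathbb{R}$ be a function, and put $\gamma_f=\sum_{j=1}^N\pi(j)f(j)$ and $S_kf(z)=\sum_{i=0}^kf(x_i)$ for $z=(x_0,\dots,x_k)\in G_k$. Then there exists $\sigma^2\ge0$ such that, as $k\to\infty$, the law under $\mu_k$ of $$\frac{S_kf-(k+1)\gamma_f}{\sqrt{k+1}}$$ converges weakly to the normal law $\mathcal{N}(0,\sigma^2)$, where $\mathcal N(0,0)$ is the Dirac mass at $0$. Moreover, $\sigma^2=0$ if and only if there exists a function $g:\{1,\dots,N\}\to\mathbb{R}$ such that $f(i)=\gamma_f+g(i)-g(j)$ for all $i,j$ in the support of $\pi$ with $M_{i,j}>0$. -/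

import Mathlib

open MeasureTheory ProbabilityTheory Filter Topology Matrix

open scoped NNReal

noncomputable section

/-- `lam` is the unique eigenvalue of maximal modulus of the real matrix `M` (among its complex
eigenvalues), and it is simple, i.e. of algebraic multiplicity one. -/
def IsDominantEigenvalue {N : ℕ} (M : Matrix (Fin N) (Fin N) ℝ) (lam : ℂ) : Prop :=
  (M.map (algebraMap ℝ ℂ)).charpoly.rootMultiplicity lam = 1 ∧
    ∀ z ∈ spectrum ℂ (M.map (algebraMap ℝ ℂ)), z ≠ lam → ‖z‖ < ‖lam‖

/-- `ell` is a nonzero non-negative left (row) eigenvector of `M` for the eigenvalue `lam`. -/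
def IsNonnegLeftEigenvector {N : ℕ} (M : Matrix (Fin N) (Fin N) ℝ) (lam : ℂ)
    (ell : Fin N → ℝ) : Prop :=
  ell ≠ 0 ∧ (∀ i, 0 ≤ ell i) ∧
    (fun i => (ell i : ℂ)) ᵥ* M.map (algebraMap ℝ ℂ) = lam • (fun i => (ell i : ℂ))

/-- `r` is a nonzero non-negative right (column) eigenvector of `M` for the eigenvalue `lam`. -/
def IsNonnegRightEigenvector {N : ℕ} (M : Matrix (Fin N) (Fin N) ℝ) (lam : ℂ)
    (r : Fin N → ℝ) : Prop :=
  r ≠ 0 ∧ (∀ i, 0 ≤ r i) ∧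
    M.map (algebraMap ℝ ℂ) *ᵥ (fun i => (r i : ℂ)) = lam • (fun i => (r i : ℂ))

/-- Conditioned weighted graphs `(M, w⁻, w⁺)` on the vertex set `Fin N`. -/
structure CWG (N : ℕ) where
  M : Matrix (Fin N) (Fin N) ℝ
  /-- The initial weights `w⁻`. -/
  wInit : Fin N → ℝ
  /-- The final weights `w⁺`. -/
  wFinal : Fin N → ℝ
  one_lt : 1 < N
  M_nonneg : ∀ i j, 0 ≤ M i j
  wInit_nonneg : ∀ i, 0 ≤ wInit i
  wFinal_nonneg : ∀ i, 0 ≤ wFinal i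
  exists_dominant : ∃ lam : ℂ, IsDominantEigenvalue M lam
  weights_pos : ∀ (lam : ℂ) (ell r : Fin N → ℝ), IsDominantEigenvalue M lam →
    IsNonnegLeftEigenvector M lam ell → IsNonnegRightEigenvector M lam r →
      0 < wInit ⬝ᵥ r ∧ 0 < ell ⬝ᵥ wFinal

namespace CWG

variable {N : ℕ}

/-- The set `G_k` of paths `(x_0, …, x_k)` of length `k`. -/
abbrev Path (G : CWG N) (k : ℕ) : Type :=
  {x : Fin (k + 1) → Fin N // ∀ i : Fin k, 0 < G.M (x i.castSucc) (x i.succ)}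

instance (G : CWG N) (k : ℕ) : Fintype (G.Path k) := Fintype.ofFinite _

/-- The weight `w⁻(x_0) M_{x_0,x_1} ⋯ M_{x_{k-1},x_k} w⁺(x_k)` of a path. -/
def weight (G : CWG N) {k : ℕ} (x : G.Path k) : ℝ :=
  G.wInit (x.1 0) * (∏ i : Fin k, G.M (x.1 i.castSucc) (x.1 i.succ)) *
    G.wFinal (x.1 (Fin.last k))

/-- The normalization factor `Z_k`. -/
def Z (G : CWG N) (k : ℕ) : ℝ := ∑ x : G.Path k, G.weight x

/-- The weighted distribution `μ_k` on `G_k`, giving mass `w(x) / Z_k` to the path `x`.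
It is a probability measure as soon as `Z_k ≠ 0`, which holds for all large `k`; when `Z_k = 0`
it is the zero measure. -/
def weightedDist (G : CWG N) (k : ℕ) : FiniteMeasure (G.Path k) :=
  ⟨∑ x : G.Path k, ENNReal.ofReal (G.weight x / G.Z k) • Measure.dirac x,
    ⟨by simp [Measure.finsetSum_apply]⟩⟩

/-- The space `Ω` of finite (non empty) and infinite paths. A path is encoded as the sequence of
its vertices, followed by `none` forever if it is finite. -/
structure PathSpace (G : CWG N) where
  /-- The `n`-th vertex, or `none` if the path has fewer than `n + 1` vertices. -/
  vertex : ℕ → Option (Fin N)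
  vertex_zero : vertex 0 ≠ none
  edge : ∀ n j, vertex (n + 1) = some j → ∃ i, vertex n = some i ∧ 0 < G.M i j

/-- The topology of `Ω`: coordinatewise convergence, each coordinate being in a discrete space. -/
instance (G : CWG N) : TopologicalSpace G.PathSpace :=
  TopologicalSpace.induced PathSpace.vertex
    (@Pi.topologicalSpace ℕ (fun _ => Option (Fin N)) (fun _ => ⊥))

instance (G : CWG N) : MeasurableSpace G.PathSpace := borel _

instance (G : CWG N) : BorelSpace G.PathSpace := ⟨rfl⟩

/-- The embedding of `G_k` into `Ω`. -/
def embed (G : CWG N) {k : ℕ} (x : G.Path k) : G.PathSpace where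
  vertex n := if h : n < k + 1 then some (x.1 ⟨n, h⟩) else none
  vertex_zero := by simp
  edge n j hj := by
    by_cases h : n + 1 < k + 1
    · have h' : n < k + 1 := by omega
      rw [dif_pos h] at hj
      refine ⟨x.1 ⟨n, h'⟩, by simp [h'], ?_⟩
      have := x.2 ⟨n, by omega⟩
      rw [← Option.some.inj hj]
      exact this
    · rw [dif_neg h] at hj
      cases hj

/-- `μ` is the limit weighted measure of `G`: the weak limit on `Ω` of the weighted
distributions `μ_k`. -/
def IsLimitWeightedMeasure (G : CWG N) (μ : ProbabilityMeasure G.PathSpace) : Prop :=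
  Tendsto (fun k => (G.weightedDist k).map (G.embed (k := k))) atTop (𝓝 μ.toFiniteMeasure)

/-- Under `μ`, the coordinates form a Markov chain with transition matrix `P`. -/
def IsTransitionMatrix (G : CWG N) (μ : ProbabilityMeasure G.PathSpace)
    (P : Matrix (Fin N) (Fin N) ℝ) : Prop :=
  (∀ i j, 0 ≤ P i j) ∧ (∀ i, ∑ j, P i j = 1) ∧
    ∀ (k : ℕ) (x : ℕ → Fin N),
      (μ : Measure G.PathSpace) {ω | ∀ n ≤ k + 1, ω.vertex n = some (x n)} =
        (μ : Measure G.PathSpace) {ω | ∀ n ≤ k, ω.vertex n = some (x n)} *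
          ENNReal.ofReal (P (x k) (x (k + 1)))

/-- `π` is a stationary probability measure, on the set of states reachable under `μ`, of the
Markov chain formed by the coordinates under `μ`. -/
def IsStationaryMeasure (G : CWG N) (μ : ProbabilityMeasure G.PathSpace) (π : Fin N → ℝ) : Prop :=
  (∀ i, 0 ≤ π i) ∧ ∑ i, π i = 1 ∧
    (∀ i, π i ≠ 0 → ∃ n, (μ : Measure G.PathSpace) {ω | ω.vertex n = some i} ≠ 0) ∧
      ∃ P : Matrix (Fin N) (Fin N) ℝ, G.IsTransitionMatrix μ P ∧ π ᵥ* P = π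

/-- The ergodic sum `S_k f` along a path of length `k`. -/
def ergodicSum (G : CWG N) (f : Fin N → ℝ) {k : ℕ} (x : G.Path k) : ℝ :=
  ∑ i : Fin (k + 1), f (x.1 i)

end CWG

end

/-! Fourier transform and transfer matrices. Simplicity of the dominant eigenvalue makes the powers
of `A = a⁻¹ M` converge to the rank-one projection `r l`, although `M` need not be irreducible and
`r`, `l` may have zeros (`IsPerronData`). Letting `k → ∞` in the weights of cylinders, `μ` is the
law of the Doob transform of `A` by `r`, and this forces `π i = l i * r i`.

For centred `f`, the characteristic function of `S_k f` under `μ_k` is a quotient whose numerator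
involves the `k`-th power of `A` twisted by `exp (i s f)`, with `s = t / √(k+1)`. Analytic
perturbation of the eigenvalue is avoided: two Poisson equations give `q_s = r + i s u - s² v / 2`
with `A_s q_s = (1 - σ s² / 2) q_s + O(s³)`. The powers of `A_s` are bounded uniformly in `s`, so
after `k` steps the error is `O(k s³) → 0`, while vectors killed by `l` are sent to `0`
(`exists_variance`). The limit is `exp (-σ t² / 2)`, and Lévy's continuity theorem concludes.

Here `σ` is the second moment of the martingale increment `f(X₁) + h(X₁) - h(X₀)` in the stationary
regime, `h = u / r`. It vanishes exactly when the increment is zero on every edge of the support,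
that is, when `f` is a coboundary there. -/

/-! ### Spectral projection and Perron data. -/

theorem tendsto_pow_zero_of_forall_spectrum_norm_lt_one {A : Type*} [NormedRing A]
    [NormedAlgebra ℂ A] [CompleteSpace A] [Nontrivial A] (a : A)
    (h : ∀ z ∈ spectrum ℂ a, ‖z‖ < 1) : Tendsto (fun n : ℕ => a ^ n) atTop (𝓝 0) := by
  have hr : spectralRadius ℂ a < (1 : ℝ≥0) :=
    spectrum.spectralRadius_lt_of_forall_lt a fun z hz => by exact_mod_cast h z hz
  obtain ⟨c, hc1, hc2⟩ := exists_between hr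
  lift c to ℝ≥0 using hc2.ne_top
  have hc : c < 1 := by exact_mod_cast hc2
  -- Gelfand's formula: eventually `‖a ^ n‖ ≤ c ^ n` with `c < 1`.
  have hev := (spectrum.pow_nnnorm_pow_one_div_tendsto_nhds_spectralRadius a).eventually_lt_const
    hc1
  rw [tendsto_zero_iff_norm_tendsto_zero]
  refine squeeze_zero' (g := fun n : ℕ => (c : ℝ) ^ n) (Eventually.of_forall fun n => norm_nonneg _)
    ?_ (tendsto_pow_atTop_nhds_zero_of_lt_one c.2 (by exact_mod_cast hc))
  filter_upwards [hev, eventually_gt_atTop 0] with n hn hn0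
  have hn' : (n : ℝ) ≠ 0 := by exact_mod_cast hn0.ne'
  have h2 := ENNReal.rpow_le_rpow hn.le (Nat.cast_nonneg n)
  rw [← ENNReal.rpow_mul, one_div_mul_cancel hn', ENNReal.rpow_one, ENNReal.rpow_natCast] at h2
  have h3 : ‖a ^ n‖₊ ≤ c ^ n := by exact_mod_cast h2
  exact_mod_cast h3

namespace IsDominantEigenvalue

open Polynomial

variable {N : ℕ} {M : Matrix (Fin N) (Fin N) ℝ} {lam : ℂ}

/-- A dominant eigenvalue `0` would be the only root of the characteristic polynomial, hence of
multiplicity `N > 1`. -/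
theorem ne_zero (h : IsDominantEigenvalue M lam) (hN : 1 < N) : lam ≠ 0 := by
  rintro rfl
  set A := M.map (algebraMap ℝ ℂ)
  have hall : ∀ z ∈ A.charpoly.roots, z = 0 := by
    intro z hz
    by_contra hne
    have := h.2 z (Matrix.mem_spectrum_of_isRoot_charpoly (Polynomial.isRoot_of_mem_roots hz)) hne
    simp at this
    exact absurd this (not_lt.2 (norm_nonneg z))
  have hcard : Multiset.card A.charpoly.roots = N := by
    rw [IsAlgClosed.card_roots_eq_natDegree, Matrix.charpoly_natDegree_eq_dim, Fintype.card_fin]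
  rw [Multiset.eq_replicate_card.2 hall] at hcard
  have h1 := h.1
  rw [← Polynomial.count_roots, Multiset.eq_replicate_card.2 hall, Multiset.count_replicate_self]
    at h1
  simp only [Multiset.card_replicate] at hcard
  omega

theorem isRoot (h : IsDominantEigenvalue M lam) :
    (M.map (algebraMap ℝ ℂ)).charpoly.IsRoot lam := by
  refine (Polynomial.rootMultiplicity_pos (Matrix.charpoly_monic _).ne_zero).1 ?_
  rw [h.1]; exact one_pos

/-- The rescaled powers of a matrix converge to the spectral projection of its dominant
eigenvalue. -/
theorem exists_tendsto_pow (h : IsDominantEigenvalue M lam) (hN : 1 < N) :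
    ∃ E : Matrix (Fin N) (Fin N) ℂ,
      Tendsto (fun n : ℕ => (lam⁻¹ • M.map (algebraMap ℝ ℂ)) ^ n) atTop (𝓝 E) ∧
      M.map (algebraMap ℝ ℂ) * E = lam • E ∧ E ≠ 0 := by
  have hlam := h.ne_zero hN
  have hroot := h.isRoot
  obtain ⟨h1, h2⟩ := h
  set A := M.map (algebraMap ℝ ℂ)
  have hne : A.charpoly ≠ 0 := (Matrix.charpoly_monic A).ne_zero
  obtain ⟨q, hq, hdvd⟩ := Polynomial.exists_eq_pow_rootMultiplicity_mul_and_not_dvd _ hne lam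
  rw [h1, pow_one] at hq
  have hqlam : q.eval lam ≠ 0 := fun h0 => hdvd (Polynomial.dvd_iff_isRoot.2 h0)
  set c := q.eval lam
  have hCH : aeval A A.charpoly = 0 := Matrix.aeval_self_charpoly A
  have hvan : ∀ p : ℂ[X], A.charpoly ∣ p → aeval A p = 0 := by
    rintro p ⟨s, rfl⟩
    rw [map_mul, hCH, zero_mul]
  -- With `charpoly = (X - lam) q`, the spectral projection is `q(A) / q(lam)`; its algebra follows
  -- from Cayley–Hamilton and divisibility by `X - lam`.
  set E := aeval A (C c⁻¹ * q) with hE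
  have hAE : A * E = lam • E := by
    have := hvan ((X - C lam) * (C c⁻¹ * q)) ⟨C c⁻¹, by rw [hq]; ring⟩
    rw [map_mul, map_sub, aeval_X, aeval_C, sub_mul, ← Algebra.smul_def] at this
    exact sub_eq_zero.1 this
  have hEA : E * A = lam • E := by
    rw [← hAE]
    have : Commute (aeval A (C c⁻¹ * q)) (aeval A X) := (Commute.all _ _).map (aeval A)
    rw [aeval_X] at this
    exact this
  have hEE : E * E = E := by
    have hd : (X - C lam) ∣ (C c⁻¹ * q - 1) := by
      rw [Polynomial.dvd_iff_isRoot]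
      simp only [IsRoot.def, eval_sub, eval_mul, eval_C, eval_one]
      rw [show eval lam q = c from rfl, inv_mul_cancel₀ hqlam, sub_self]
    obtain ⟨s, hs⟩ := hd
    have := hvan ((C c⁻¹ * q - 1) * (C c⁻¹ * q)) ⟨C c⁻¹ * s, by rw [hs, hq]; ring⟩
    rw [map_mul, map_sub, map_one, sub_mul, one_mul] at this
    exact sub_eq_zero.1 this
  have hspec : lam ∈ spectrum ℂ A := Matrix.mem_spectrum_of_isRoot_charpoly hroot
  have hE0 : E ≠ 0 := by
    intro h0
    have hm := spectrum.subset_polynomial_aeval A (C c⁻¹ * q) ⟨lam, hspec, rfl⟩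
    rw [← hE, h0] at hm
    simp only [eval_mul, eval_C] at hm
    rw [show eval lam q = c from rfl, inv_mul_cancel₀ hqlam] at hm
    rw [spectrum.mem_iff] at hm
    simp at hm
  refine ⟨E, ?_, hAE, hE0⟩
  set A' := lam⁻¹ • A with hA'
  have hA'E : A' * E = E := by rw [hA', smul_mul_assoc, hAE, inv_smul_smul₀ hlam]
  have hEA' : E * A' = E := by rw [hA', mul_smul_comm, hEA, inv_smul_smul₀ hlam]
  set B := A' - E with hB
  have hBE : B * E = 0 := by rw [hB, sub_mul, hA'E, hEE, sub_self]
  have hEB : E * B = 0 := by rw [hB, mul_sub, hEA', hEE, sub_self]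
  -- `B` and `E` annihilate each other and `E` is idempotent; the exponent must be positive.
  have hpow : ∀ n : ℕ, A' ^ (n + 1) = B ^ (n + 1) + E := by
    intro n
    induction n with
    | zero => simp [hB]
    | succ n ih =>
      rw [pow_succ, ih, pow_succ B (n + 1), show A' = B + E by rw [hB]; abel, mul_add, add_mul,
        add_mul, hEB, hEE, pow_succ B n, mul_assoc _ B E, hBE]
      simp
  have hBp : B = aeval A (C lam⁻¹ * X - C c⁻¹ * q) := by
    rw [map_sub, ← hE, map_mul, aeval_X, aeval_C, ← Algebra.smul_def]
  have : Nonempty (Fin N) := ⟨⟨0, by omega⟩⟩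
  -- Spectral mapping: `lam` is sent to `1 - 1 = 0`, and any other eigenvalue `w`, being a root of
  -- `q`, to `w / lam`.
  have hBs : ∀ z ∈ spectrum ℂ B, ‖z‖ < 1 := by
    intro z hz
    rw [hBp, spectrum.map_polynomial_aeval_of_nonempty A _ ⟨lam, hspec⟩] at hz
    obtain ⟨w, hw, rfl⟩ := hz
    simp only [eval_sub, eval_mul, eval_C, eval_X]
    by_cases hwl : w = lam
    · subst hwl
      rw [show eval w q = c from rfl, inv_mul_cancel₀ hqlam, inv_mul_cancel₀ hlam]
      simp
    · have hw0 : A.charpoly.eval w = 0 := Matrix.mem_spectrum_iff_isRoot_charpoly.1 hw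
      rw [hq, eval_mul, eval_sub, eval_X, eval_C, mul_eq_zero, sub_eq_zero] at hw0
      rw [hw0.resolve_left hwl, mul_zero, sub_zero, norm_mul, norm_inv,
        inv_mul_lt_iff₀ (norm_pos_iff.2 hlam), mul_one]
      exact h2 w hw hwl
  have hB0 : Tendsto (fun n : ℕ => B ^ n) atTop (𝓝 0) := by
    let _ := Matrix.linftyOpNormedRing (n := Fin N) (α := ℂ)
    let _ := Matrix.linftyOpNormedAlgebra (n := Fin N) (R := ℂ) (α := ℂ)
    exact tendsto_pow_zero_of_forall_spectrum_norm_lt_one B hBs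
  rw [← tendsto_add_atTop_iff_nat 1]
  simp only [hpow]
  simpa using ((tendsto_add_atTop_iff_nat 1).2 hB0).add_const E

/-- Two eigenvectors of a simple eigenvalue are proportional. -/
theorem exists_smul_eq (h : IsDominantEigenvalue M lam) {v w : Fin N → ℂ}
    (hv : M.map (algebraMap ℝ ℂ) *ᵥ v = lam • v) (hv0 : v ≠ 0)
    (hw : M.map (algebraMap ℝ ℂ) *ᵥ w = lam • w) : ∃ c : ℂ, c • v = w := by
  set φ : Module.End ℂ (Fin N → ℂ) := Matrix.toLin' (M.map (algebraMap ℝ ℂ))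
  -- Geometric multiplicity is at most algebraic multiplicity.
  have hle : Module.finrank ℂ (φ.eigenspace lam) ≤ 1 := by
    refine (LinearMap.finrank_eigenspace_le φ lam).trans ?_
    rw [Matrix.charpoly_toLin', h.1]
  have hv' : v ∈ φ.eigenspace lam := Module.End.mem_eigenspace_iff.2 hv
  have hw' : w ∈ φ.eigenspace lam := Module.End.mem_eigenspace_iff.2 hw
  rcases Nat.le_one_iff_eq_zero_or_eq_one.1 hle with h0 | h1
  · rw [Submodule.finrank_eq_zero] at h0
    rw [h0] at hv'
    exact absurd ((Submodule.mem_bot ℂ).1 hv') hv0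
  · obtain ⟨c, hc⟩ := (finrank_eq_one_iff_of_nonzero' (⟨v, hv'⟩ : φ.eigenspace lam)
      (fun h => hv0 (congrArg Subtype.val h))).1 h1 ⟨w, hw'⟩
    exact ⟨c, congrArg Subtype.val hc⟩

end IsDominantEigenvalue

/-- The common conclusions of the Perron–Frobenius theorem for a rescaled matrix `A`, with right
eigenvector `r` and left eigenvector `l` normalized by `l ⬝ᵥ r = 1`. -/
structure IsPerronData {N : ℕ} (A : Matrix (Fin N) (Fin N) ℝ) (r l : Fin N → ℝ) : Prop where
  nonneg : ∀ i j, 0 ≤ A i j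
  right_nonneg : ∀ i, 0 ≤ r i
  left_nonneg : ∀ i, 0 ≤ l i
  mulVec_right : A *ᵥ r = r
  left_vecMul : l ᵥ* A = l
  dotProduct_eq : l ⬝ᵥ r = 1
  tendsto_pow : Tendsto (fun n : ℕ => A ^ n) atTop (𝓝 (vecMulVec r l))

/-- A nonzero limit of nonnegative reals rescaled by the powers of a complex number forces this
number to be a nonnegative real. -/
theorem Complex.eq_ofReal_of_tendsto_inv_pow_mul {b : ℕ → ℝ} (hb : ∀ n, 0 ≤ b n) {lam c : ℂ}
    (hlam : lam ≠ 0) (hc : c ≠ 0) (h : Tendsto (fun n => lam⁻¹ ^ n * (b n : ℂ)) atTop (𝓝 c)) :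
    0 ≤ lam.re ∧ lam = lam.re := by
  -- Quotient of consecutive terms of the convergent sequence; a real sequence tending to `lam`
  -- makes `lam` real.
  have h1 : Tendsto (fun n => ((b (n + 1) / b n : ℝ) : ℂ)) atTop (𝓝 lam) := by
    have h2 := (((tendsto_add_atTop_iff_nat 1).2 h).div h hc).const_mul lam
    rw [div_self hc, mul_one] at h2
    refine h2.congr fun n => ?_
    simp only [Pi.div_apply, pow_succ]
    by_cases h0 : (b n : ℂ) = 0
    · simp [h0]
    · push_cast
      field_simp
  have hre : Tendsto (fun n => b (n + 1) / b n) atTop (𝓝 lam.re) :=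
    (Complex.continuous_re.tendsto _).comp h1
  have him : Tendsto (fun _ : ℕ => (0 : ℝ)) atTop (𝓝 lam.im) := by
    simpa [Function.comp_def] using (Complex.continuous_im.tendsto _).comp h1
  have him0 := tendsto_nhds_unique him tendsto_const_nhds
  refine ⟨ge_of_tendsto' hre fun n => div_nonneg (hb _) (hb _), ?_⟩
  apply Complex.ext <;> simp [him0]

namespace IsDominantEigenvalue

variable {N : ℕ} {M : Matrix (Fin N) (Fin N) ℝ} {lam : ℂ}

/-- Everything is read off the limit `E` of the rescaled powers. A nonzero entry of `E` forces `lam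
> 0`, so `E` is real and nonnegative. Its columns are eigenvectors, so simplicity gives rank one;
`r` is the column through that entry, `l` its row divided by the entry, and `E² = E` yields `l ⬝ᵥ r
= 1`. -/
theorem exists_isPerronData (h : IsDominantEigenvalue M lam) (hN : 1 < N)
    (hM : ∀ i j, 0 ≤ M i j) :
    ∃ (a : ℝ) (r l : Fin N → ℝ), 0 < a ∧ lam = a ∧ IsPerronData (a⁻¹ • M) r l := by
  have hlam := h.ne_zero hN
  obtain ⟨E, hE, hME, hE0⟩ := h.exists_tendsto_pow hN
  have hpow : ∀ n : ℕ, (M.map (algebraMap ℝ ℂ)) ^ n = (M ^ n).map (algebraMap ℝ ℂ) := fun n =>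
    ((algebraMap ℝ ℂ).mapMatrix.map_pow M n).symm
  have hMn : ∀ (n : ℕ) i j, 0 ≤ (M ^ n) i j := by
    intro n
    induction n with
    | zero => intro i j; simp only [pow_zero, Matrix.one_apply]; split_ifs <;> norm_num
    | succ n ih =>
      intro i j
      rw [pow_succ, Matrix.mul_apply]
      exact Finset.sum_nonneg fun k _ => mul_nonneg (ih i k) (hM k j)
  have hent : ∀ i j, Tendsto (fun n : ℕ => lam⁻¹ ^ n * (((M ^ n) i j : ℝ) : ℂ)) atTop
      (𝓝 (E i j)) := by
    intro i j
    have := (tendsto_pi_nhds.1 ((tendsto_pi_nhds.1 hE) i)) j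
    refine this.congr fun n => ?_
    rw [smul_pow, hpow]
    rfl
  obtain ⟨i₀, j₀, hij⟩ : ∃ i j, E i j ≠ 0 := by
    by_contra! hcon
    exact hE0 (Matrix.ext hcon)
  obtain ⟨ha, hla⟩ := Complex.eq_ofReal_of_tendsto_inv_pow_mul (fun n => hMn n i₀ j₀) hlam hij
    (hent i₀ j₀)
  set a := lam.re with ha_def
  have ha0 : 0 < a := lt_of_le_of_ne ha fun h0 => hlam (by rw [hla, ← h0]; simp)
  set A := a⁻¹ • M with hA
  have hAn : ∀ (n : ℕ) i j, (A ^ n) i j = a⁻¹ ^ n * (M ^ n) i j := by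
    intro n i j
    rw [hA, smul_pow]; rfl
  have hentR : ∀ i j, Tendsto (fun n : ℕ => (A ^ n) i j) atTop (𝓝 (E i j).re) := by
    intro i j
    refine ((Complex.continuous_re.tendsto _).comp (hent i j)).congr fun n => ?_
    rw [hAn, hla]
    simp only [Function.comp_apply]
    rw [← Complex.ofReal_inv, ← Complex.ofReal_pow, ← Complex.ofReal_mul, Complex.ofReal_re]
  have hEre : ∀ i j, E i j = (E i j).re := by
    intro i j
    refine tendsto_nhds_unique (hent i j) ?_
    refine ((Complex.continuous_ofReal.tendsto _).comp (hentR i j)).congr fun n => ?_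
    simp only [Function.comp_apply]
    rw [hAn, hla]
    push_cast
    rfl
  set R : Matrix (Fin N) (Fin N) ℝ := fun i j => (E i j).re with hR
  have hAR : Tendsto (fun n : ℕ => A ^ n) atTop (𝓝 R) :=
    tendsto_pi_nhds.2 fun i => tendsto_pi_nhds.2 fun j => hentR i j
  have hR0 : ∀ i j, 0 ≤ R i j := fun i j => ge_of_tendsto' (hentR i j) fun n => by
    rw [hAn]; exact mul_nonneg (pow_nonneg (inv_nonneg.2 ha) _) (hMn n i j)
  have hRij : R i₀ j₀ ≠ 0 := fun h0 => hij (by rw [hEre]; exact_mod_cast h0)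
  have hA_R : A * R = R := by
    refine tendsto_nhds_unique (hAR.const_mul A) ?_
    refine ((tendsto_add_atTop_iff_nat 1).2 hAR).congr fun n => pow_succ' A n
  have hR_A : R * A = R := by
    refine tendsto_nhds_unique (hAR.mul_const A) ?_
    refine ((tendsto_add_atTop_iff_nat 1).2 hAR).congr fun n => pow_succ A n
  have hAnR : ∀ n : ℕ, A ^ n * R = R := by
    intro n
    induction n with
    | zero => simp
    | succ n ih => rw [pow_succ, mul_assoc, hA_R, ih]
  have hRR : R * R = R := by
    refine tendsto_nhds_unique (hAR.mul_const R) ?_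
    simp only [hAnR]
    exact tendsto_const_nhds
  have hcol : ∀ j, M.map (algebraMap ℝ ℂ) *ᵥ (fun i => E i j) = lam • fun i => E i j := by
    intro j
    ext i
    exact congrFun (congrFun hME i) j
  have hrank : ∀ i j, R i j * R i₀ j₀ = R i j₀ * R i₀ j := by
    intro i j
    obtain ⟨c, hc⟩ := h.exists_smul_eq (hcol j₀) (fun h0 => hij (congrFun h0 i₀)) (hcol j)
    have e1 : c * E i j₀ = E i j := congrFun hc i
    have e2 : c * E i₀ j₀ = E i₀ j := congrFun hc i₀
    have : E i j * E i₀ j₀ = E i j₀ * E i₀ j := by rw [← e1, ← e2]; ring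
    rw [hEre i j, hEre i₀ j₀, hEre i j₀, hEre i₀ j] at this
    exact_mod_cast this
  have hvec : R = vecMulVec (fun i => R i j₀) (fun j => R i₀ j / R i₀ j₀) := by
    ext i j
    rw [vecMulVec_apply, mul_div_assoc', ← hrank, mul_div_cancel_right₀ _ hRij]
  refine ⟨a, fun i => R i j₀, fun j => R i₀ j / R i₀ j₀, ha0, hla,
    fun i j => mul_nonneg (inv_nonneg.2 ha) (hM i j), fun i => hR0 i j₀,
    fun j => div_nonneg (hR0 _ _) (hR0 _ _), ?_, ?_, ?_, hvec ▸ hAR⟩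
  · ext i
    exact congrFun (congrFun hA_R i) j₀
  · ext j
    have := congrFun (congrFun hR_A i₀) j
    rw [Matrix.mul_apply] at this
    simp only [vecMul, dotProduct, div_mul_eq_mul_div]
    rw [← Finset.sum_div, this]
  · have := congrFun (congrFun hRR i₀) j₀
    rw [Matrix.mul_apply] at this
    simp only [dotProduct, div_mul_eq_mul_div]
    rw [← Finset.sum_div, this, div_self hRij]

end IsDominantEigenvalue

namespace CWG

variable {N : ℕ}

/-- The positivity of the two products, supplied by `weights_pos`, is what makes the limit of `a⁻ᵏ
Z_k` nonzero. -/
theorem exists_isPerronData (G : CWG N) :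
    ∃ (a : ℝ) (r l : Fin N → ℝ), 0 < a ∧ IsPerronData (a⁻¹ • G.M) r l ∧
      0 < G.wInit ⬝ᵥ r ∧ 0 < l ⬝ᵥ G.wFinal := by
  obtain ⟨lam, hlam⟩ := G.exists_dominant
  obtain ⟨a, r, l, ha, hla, hP⟩ := hlam.exists_isPerronData G.one_lt G.M_nonneg
  have hr : r ≠ 0 := by rintro rfl; simpa using hP.dotProduct_eq
  have hl : l ≠ 0 := by rintro rfl; simpa using hP.dotProduct_eq
  have h1 : G.M *ᵥ r = a • r := by
    have := hP.mulVec_right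
    rw [smul_mulVec, inv_smul_eq_iff₀ ha.ne'] at this
    exact this
  have h2 : l ᵥ* G.M = a • l := by
    have := hP.left_vecMul
    rw [vecMul_smul, inv_smul_eq_iff₀ ha.ne'] at this
    exact this
  refine ⟨a, r, l, ha, hP, G.weights_pos lam l r hlam ⟨hl, hP.left_nonneg, ?_⟩
    ⟨hr, hP.right_nonneg, ?_⟩⟩
  · ext j
    have := congrFun h2 j
    simp only [vecMul, dotProduct, Pi.smul_apply, smul_eq_mul, Matrix.map_apply, hla,
      Complex.coe_algebraMap] at this ⊢
    exact_mod_cast this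
  · ext i
    have := congrFun h1 i
    simp only [mulVec, dotProduct, Pi.smul_apply, smul_eq_mul, Matrix.map_apply, hla,
      Complex.coe_algebraMap] at this ⊢
    exact_mod_cast this

end CWG

/-! ### Path sums as matrix products. -/

/-- The product `B 0 * B 1 * ⋯ * B (k - 1)`. -/
def Matrix.orderedProd {n R : Type*} [Fintype n] [DecidableEq n] [Semiring R]
    (B : ℕ → Matrix n n R) : ℕ → Matrix n n R
  | 0 => 1
  | k + 1 => Matrix.orderedProd B k * B k

namespace Matrix

variable {n R : Type*} [Fintype n] [DecidableEq n]

theorem orderedProd_const [Semiring R] (A : Matrix n n R) (k : ℕ) :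
    orderedProd (fun _ => A) k = A ^ k := by
  induction k with
  | zero => rfl
  | succ k ih => rw [pow_succ, ← ih]; rfl

theorem orderedProd_add [Semiring R] (B : ℕ → Matrix n n R) (A : Matrix n n R) (m : ℕ)
    (h : ∀ i, m ≤ i → B i = A) (j : ℕ) :
    orderedProd B (m + j) = orderedProd B m * A ^ j := by
  induction j with
  | zero => simp
  | succ j ih =>
    rw [← add_assoc, pow_succ, ← mul_assoc, ← ih, ← h (m + j) (by omega)]
    rfl

/-- The sum of the weights of all paths as a matrix product. -/
theorem sum_path_eq_dotProduct [CommSemiring R] (B : ℕ → Matrix n n R) (a : n → R) (k : ℕ) :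
    ∀ b : n → R, ∑ y : Fin (k + 1) → n,
      a (y 0) * (∏ i : Fin k, B i (y i.castSucc) (y i.succ)) * b (y (Fin.last k)) =
        a ⬝ᵥ (orderedProd B k *ᵥ b) := by
  induction k with
  | zero =>
    intro b
    rw [← (Equiv.funUnique (Fin 1) n).symm.sum_comp]
    simp [orderedProd, dotProduct, Equiv.funUnique]
  | succ k ih =>
    intro b
    have h := ih (B k *ᵥ b)
    rw [orderedProd, ← mulVec_mulVec, ← h, ← (Fin.snocEquiv fun _ => n).sum_comp,
      Fintype.sum_prod_type_right]
    refine Finset.sum_congr rfl fun y _ => ?_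
    simp only [mulVec, dotProduct, Finset.mul_sum]
    refine Finset.sum_congr rfl fun z _ => ?_
    have h0 : (Fin.snoc y z : Fin (k + 2) → n) 0 = y 0 := by
      rw [← Fin.castSucc_zero, Fin.snoc_castSucc]
    rw [Fin.prod_univ_castSucc]
    simp only [Fin.snocEquiv_apply, Fin.succ_last, Fin.snoc_last, Fin.snoc_castSucc, h0,
      Fin.succ_castSucc, Fin.val_castSucc, Fin.val_last]
    ring

end Matrix

namespace CWG

variable {N : ℕ} (G : CWG N)

/-- Sequences that are not paths contribute zero, so the sum may run over all sequences.
Time-dependent `B` serves for cylinders, complex `B` for characteristic functions. -/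
theorem sum_path_eq_dotProduct {R : Type*} [CommSemiring R] (B : ℕ → Matrix (Fin N) (Fin N) R)
    (hB : ∀ n i j, G.M i j = 0 → B n i j = 0) (a b : Fin N → R) (k : ℕ) :
    ∑ x : G.Path k, a (x.1 0) * (∏ i : Fin k, B i (x.1 i.castSucc) (x.1 i.succ)) *
      b (x.1 (Fin.last k)) = a ⬝ᵥ (orderedProd B k *ᵥ b) := by
  rw [← Matrix.sum_path_eq_dotProduct]
  refine Fintype.sum_of_injective Subtype.val Subtype.val_injective _ _ (fun y hy => ?_)
    fun _ => rfl
  have : ∃ i : Fin k, G.M (y i.castSucc) (y i.succ) = 0 := by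
    by_contra! hcon
    exact hy ⟨⟨y, fun i => lt_of_le_of_ne (G.M_nonneg _ _) (hcon i).symm⟩, rfl⟩
  obtain ⟨i, hi⟩ := this
  rw [Finset.prod_eq_zero (Finset.mem_univ i) (hB _ _ _ hi), mul_zero, zero_mul]

theorem Z_eq_dotProduct (k : ℕ) : G.Z k = G.wInit ⬝ᵥ (G.M ^ k *ᵥ G.wFinal) := by
  rw [← orderedProd_const, ← G.sum_path_eq_dotProduct _ fun _ _ _ h => h]
  rfl

theorem weight_nonneg {k : ℕ} (x : G.Path k) : 0 ≤ G.weight x :=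
  mul_nonneg (mul_nonneg (G.wInit_nonneg _) (Finset.prod_nonneg fun _ _ => G.M_nonneg _ _))
    (G.wFinal_nonneg _)

theorem Z_nonneg (k : ℕ) : 0 ≤ G.Z k := Finset.sum_nonneg fun x _ => G.weight_nonneg x

/-- The generating function of the ergodic sums. -/
theorem sum_weight_mul_exp (f : Fin N → ℝ) (s : ℝ) (k : ℕ) :
    ∑ x : G.Path k, (G.weight x : ℂ) * Complex.exp (s * G.ergodicSum f x * Complex.I) =
      (fun i => (G.wInit i : ℂ) * Complex.exp (s * f i * Complex.I)) ⬝ᵥ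
        ((of fun i j => (G.M i j : ℂ) * Complex.exp (s * f j * Complex.I)) ^ k *ᵥ
          fun i => (G.wFinal i : ℂ)) := by
  rw [← orderedProd_const, ← G.sum_path_eq_dotProduct _ fun _ i j h => by simp [h]]
  refine Finset.sum_congr rfl fun x _ => ?_
  have h : Complex.exp (s * G.ergodicSum f x * Complex.I) =
      Complex.exp (s * f (x.1 0) * Complex.I) *
        ∏ i : Fin k, Complex.exp (s * f (x.1 i.succ) * Complex.I) := by
    rw [← Complex.exp_sum, ← Complex.exp_add, ergodicSum, Fin.sum_univ_succ]
    congr 1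
    push_cast
    rw [mul_add, add_mul, Finset.mul_sum, Finset.sum_mul]
  rw [h, weight]
  simp only [of_apply, Finset.prod_mul_distrib]
  push_cast
  ring

theorem integral_map_weightedDist {Y E : Type*} [MeasurableSpace Y] [NormedAddCommGroup E]
    [NormedSpace ℝ E] [CompleteSpace E] {k : ℕ} (φ : G.Path k → Y) (g : Y → E)
    (hg : StronglyMeasurable g) :
    ∫ y, g y ∂((G.weightedDist k).map φ : Measure Y) =
      ∑ x : G.Path k, (G.weight x / G.Z k) • g (φ x) := by
  have hm : ((G.weightedDist k).map φ : Measure Y) =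
      (∑ x : G.Path k, ENNReal.ofReal (G.weight x / G.Z k) • Measure.dirac x).map φ := rfl
  rw [hm, integral_map (Measurable.of_discrete).aemeasurable hg.aestronglyMeasurable,
    integral_finsetSum_measure]
  · refine Finset.sum_congr rfl fun x _ => ?_
    rw [integral_smul_measure, integral_dirac,
      ENNReal.toReal_ofReal (div_nonneg (G.weight_nonneg x) (G.Z_nonneg k))]
  · intro x _
    exact (integrable_dirac (by simp [enorm_lt_top])).smul_measure ENNReal.ofReal_ne_top

/-- Makes the indicator of a cylinder a continuous test function for weak convergence. -/
theorem isClopen_cylinder (m : ℕ) (x : ℕ → Fin N) :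
    IsClopen {ω : G.PathSpace | ∀ n ≤ m, ω.vertex n = some (x n)} := by
  let _ : TopologicalSpace (Option (Fin N)) := ⊥
  have : DiscreteTopology (Option (Fin N)) := ⟨rfl⟩
  have hc : ∀ n, Continuous fun ω : G.PathSpace => ω.vertex n := fun n =>
    (continuous_apply n).comp continuous_induced_dom
  have : {ω : G.PathSpace | ∀ n ≤ m, ω.vertex n = some (x n)} =
      ⋂ n ∈ Finset.range (m + 1), (fun ω : G.PathSpace => ω.vertex n) ⁻¹' {some (x n)} := by
    ext ω
    simp
  rw [this]
  exact isClopen_biInter_finset fun n _ => (isClopen_discrete _).preimage (hc n)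

-- The constraint is absorbed into the matrices: the initial vector and the first `m` factors are
-- cut down to the single entries prescribed by `x`.
open scoped Classical in
theorem sum_weight_cylinder (m j : ℕ) (x : ℕ → Fin N) :
    ∑ y : G.Path (m + j), G.weight y *
      (if ∀ n ≤ m, (G.embed y).vertex n = some (x n) then 1 else 0) =
      G.wInit (x 0) * (∏ n ∈ Finset.range m, G.M (x n) (x (n + 1))) *
        (G.M ^ j *ᵥ G.wFinal) (x m) := by
  set a : Fin N → ℝ := Pi.single (x 0) (G.wInit (x 0)) with ha
  set B : ℕ → Matrix (Fin N) (Fin N) ℝ := fun n =>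
    if n < m then Matrix.single (x n) (x (n + 1)) (G.M (x n) (x (n + 1))) else G.M with hB
  have hB0 : ∀ n i j, G.M i j = 0 → B n i j = 0 := by
    intro n i j h
    simp only [hB]
    split_ifs
    · rw [Matrix.single_apply]
      split_ifs with h'
      · rw [h'.1, h'.2, h]
      · rfl
    · exact h
  have hsum := G.sum_path_eq_dotProduct B hB0 a G.wFinal (m + j)
  have hvec : ∀ p ≤ m, a ᵥ* orderedProd B p =
      Pi.single (x p) (G.wInit (x 0) * ∏ n ∈ Finset.range p, G.M (x n) (x (n + 1))) := by
    intro p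
    induction p with
    | zero => intro _; simp [orderedProd, ha]
    | succ p ih =>
      intro hp
      rw [orderedProd, ← vecMul_vecMul, ih (by omega), Finset.prod_range_succ, ← mul_assoc]
      ext q
      rw [single_vecMul]
      simp only [hB, if_pos (show p < m by omega), Pi.smul_apply, row_apply, Matrix.single_apply,
        Pi.single_apply, smul_eq_mul, true_and, eq_comm (a := q)]
      split_ifs <;> simp
  rw [orderedProd_add B G.M m (fun i hi => by simp [hB, not_lt.2 hi]), ← mulVec_mulVec,
    dotProduct_mulVec, hvec m le_rfl, single_dotProduct] at hsum
  rw [← hsum]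
  refine Finset.sum_congr rfl fun y _ => ?_
  have hv : ∀ n (hn : n < m + j + 1), (G.embed y).vertex n = some (y.1 ⟨n, hn⟩) := fun n hn =>
    dif_pos hn
  split_ifs with hy
  · have hyx : ∀ n (hn : n ≤ m), y.1 ⟨n, by omega⟩ = x n := fun n hn =>
      Option.some.inj ((hv n (by omega)).symm.trans (hy n hn))
    have h0 : a (y.1 0) = G.wInit (y.1 0) := by
      rw [show y.1 0 = x 0 from hyx 0 (Nat.zero_le m), ha, Pi.single_eq_same]
    rw [mul_one, weight, h0]
    congr 2
    refine Finset.prod_congr rfl fun i _ => ?_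
    simp only [hB]
    split_ifs with him
    · have e1 : y.1 i.castSucc = x i := hyx i (by omega)
      have e2 : y.1 i.succ = x (i + 1) := hyx (i + 1) (by omega)
      rw [e1, e2, Matrix.single_apply_same]
    · rfl
  · push Not at hy
    obtain ⟨n, hn, hne⟩ := hy
    rw [hv n (by omega), ne_eq, Option.some_inj] at hne
    rw [mul_zero]
    rcases n with _ | n
    · rw [ha, Pi.single_eq_of_ne (show y.1 0 ≠ x 0 from hne), zero_mul, zero_mul]
    · rw [Finset.prod_eq_zero (Finset.mem_univ (⟨n, by omega⟩ : Fin (m + j))), mul_zero, zero_mul]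
      simp only [hB, if_pos (show n < m by omega), Matrix.single_apply]
      exact if_neg fun h => hne h.2.symm

end CWG

/-! ### The limit measure as a Doob transform, and its stationary law. -/

namespace IsPerronData

variable {N : ℕ} {A : Matrix (Fin N) (Fin N) ℝ} {r l : Fin N → ℝ}

theorem tendsto_pow_mulVec (h : IsPerronData A r l) (v : Fin N → ℝ) :
    Tendsto (fun n : ℕ => A ^ n *ᵥ v) atTop (𝓝 ((l ⬝ᵥ v) • r)) := by
  have h1 : Tendsto (fun n : ℕ => A ^ n *ᵥ v) atTop (𝓝 (vecMulVec r l *ᵥ v)) :=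
    ((Continuous.matrix_mulVec continuous_id continuous_const).tendsto _).comp h.tendsto_pow
  rwa [vecMulVec_mulVec, op_smul_eq_smul] at h1

theorem tendsto_vecMul_pow (h : IsPerronData A r l) (v : Fin N → ℝ) :
    Tendsto (fun n : ℕ => v ᵥ* A ^ n) atTop (𝓝 ((v ⬝ᵥ r) • l)) := by
  have h1 : Tendsto (fun n : ℕ => v ᵥ* A ^ n) atTop (𝓝 (v ᵥ* vecMulVec r l)) :=
    ((Continuous.matrix_vecMul continuous_const continuous_id).tendsto _).comp h.tendsto_pow
  rwa [vecMul_vecMulVec] at h1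

theorem right_pos_of_pos (h : IsPerronData A r l) {i j : Fin N} (hij : 0 < A i j)
    (hj : 0 < r j) : 0 < r i := by
  have h1 := congrFun h.mulVec_right i
  rw [← h1]
  exact (mul_pos hij hj).trans_le (Finset.single_le_sum (f := fun j => A i j * r j)
    (fun j _ => mul_nonneg (h.nonneg i j) (h.right_nonneg j)) (Finset.mem_univ j))

theorem left_pos_of_pos (h : IsPerronData A r l) {i j : Fin N} (hij : 0 < A i j)
    (hi : 0 < l i) : 0 < l j := by
  have h1 := congrFun h.left_vecMul j
  rw [← h1]
  exact (mul_pos hi hij).trans_le (Finset.single_le_sum (f := fun i => l i * A i j)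
    (fun i _ => mul_nonneg (h.left_nonneg i) (h.nonneg i j)) (Finset.mem_univ i))

/-- The stationary measure of the Markov chain with transition matrix `A i j * r j / r i` is
`l i * r i`. -/
theorem stationary_eq (h : IsPerronData A r l) {π : Fin N → ℝ} (hsum : ∑ i, π i = 1)
    {P : Matrix (Fin N) (Fin N) ℝ} (hP : ∀ i, π i ≠ 0 → r i ≠ 0 ∧ ∀ j, r i * P i j = A i j * r j)
    (hπ : π ᵥ* P = π) (j : Fin N) : π j = l j * r j := by
  -- Undoing the Doob transform: `π P = π` becomes `(u A) r = u r` coordinatewise. Iterating, `(u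
  -- Aⁿ) r = π`, whose limit is `(u ⬝ᵥ r) l r`; this needs no irreducibility.
  set u : Fin N → ℝ := fun i => π i / r i with hu
  have hur : ∀ i, u i * r i = π i := by
    intro i
    by_cases h0 : π i = 0
    · simp [hu, h0]
    · exact div_mul_cancel₀ _ (hP i h0).1
  have hstep : ∀ j, (u ᵥ* A) j * r j = π j := by
    intro j
    rw [← congrFun hπ j]
    simp only [vecMul, dotProduct, Finset.sum_mul]
    refine Finset.sum_congr rfl fun i _ => ?_
    by_cases h0 : π i = 0
    · simp [hu, h0]
    · rw [mul_assoc, ← (hP i h0).2 j, ← mul_assoc, hur]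
  have hpow : ∀ (n : ℕ) j, (u ᵥ* A ^ n) j * r j = π j := by
    intro n
    induction n with
    | zero => intro j; simp [hur]
    | succ n ih =>
      intro j
      rw [← hstep j, pow_succ, ← vecMul_vecMul]
      rcases eq_or_ne (r j) 0 with hj | hj
      · rw [hj, mul_zero, mul_zero]
      · congr 1
        simp only [vecMul, dotProduct]
        -- Only `i` with `A i j > 0` count; then `r i > 0`, and the induction hypothesis can be
        -- divided by `r i`.
        refine Finset.sum_congr rfl fun i _ => ?_
        rcases (h.nonneg i j).eq_or_lt with h0 | h0
        · rw [← h0, mul_zero, mul_zero]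
        · have hi := h.right_pos_of_pos h0 (lt_of_le_of_ne (h.right_nonneg j) hj.symm)
          congr 1
          exact mul_right_cancel₀ hi.ne' ((ih i).trans (hur i).symm)
  have hlim := (tendsto_pi_nhds.1 (h.tendsto_vecMul_pow u) j).mul_const (r j)
  simp only [hpow] at hlim
  have h1 : u ⬝ᵥ r = 1 := by
    rw [← hsum]
    exact Finset.sum_congr rfl fun i _ => hur i
  rw [h1, one_smul] at hlim
  exact tendsto_nhds_unique tendsto_const_nhds hlim

end IsPerronData

namespace CWG

variable {N : ℕ} {G : CWG N} {a : ℝ} {r l : Fin N → ℝ}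

theorem inv_pow_mul_pow_mulVec (n : ℕ) (v : Fin N → ℝ) (i : Fin N) :
    a⁻¹ ^ n * (G.M ^ n *ᵥ v) i = ((a⁻¹ • G.M) ^ n *ᵥ v) i := by
  rw [smul_pow, smul_mulVec, Pi.smul_apply, smul_eq_mul]

theorem inv_pow_mul_Z (n : ℕ) :
    a⁻¹ ^ n * G.Z n = G.wInit ⬝ᵥ ((a⁻¹ • G.M) ^ n *ᵥ G.wFinal) := by
  rw [smul_pow, smul_mulVec, dotProduct_smul, smul_eq_mul, Z_eq_dotProduct]

theorem tendsto_inv_pow_mul_Z (hP : IsPerronData (a⁻¹ • G.M) r l) :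
    Tendsto (fun n => a⁻¹ ^ n * G.Z n) atTop (𝓝 ((l ⬝ᵥ G.wFinal) * (G.wInit ⬝ᵥ r))) := by
  simp only [inv_pow_mul_Z]
  have hc : Continuous fun v : Fin N → ℝ => G.wInit ⬝ᵥ v :=
    Continuous.dotProduct continuous_const continuous_id
  have h1 := (hc.tendsto _).comp (hP.tendsto_pow_mulVec G.wFinal)
  rwa [dotProduct_smul, smul_eq_mul] at h1

/-- In the finite-`k` formula only the remaining factor `A ^ j *ᵥ w⁺` and `a⁻ᵏ Z_k` vary; they tend
to `(l ⬝ᵥ w⁺) r` and `(l ⬝ᵥ w⁺) (w⁻ ⬝ᵥ r)`, and `l ⬝ᵥ w⁺` cancels. -/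
theorem measure_cylinder (ha : 0 < a) (hP : IsPerronData (a⁻¹ • G.M) r l)
    (hr : 0 < G.wInit ⬝ᵥ r) (hl : 0 < l ⬝ᵥ G.wFinal) {μ : ProbabilityMeasure G.PathSpace}
    (hμ : G.IsLimitWeightedMeasure μ) (m : ℕ) (x : ℕ → Fin N) :
    (μ : Measure G.PathSpace).real {ω | ∀ n ≤ m, ω.vertex n = some (x n)} =
      G.wInit (x 0) * (∏ n ∈ Finset.range m, (a⁻¹ • G.M) (x n) (x (n + 1))) * r (x m) /
        (G.wInit ⬝ᵥ r) := by
  classical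
  set C := {ω : G.PathSpace | ∀ n ≤ m, ω.vertex n = some (x n)} with hC
  have hcl : IsClopen C := G.isClopen_cylinder m x
  have hlim := FiniteMeasure.tendsto_iff_forall_integral_tendsto.1 hμ
    (BoundedContinuousFunction.indicator C hcl)
  have hμC : ∫ ω, BoundedContinuousFunction.indicator C hcl ω
      ∂(μ.toFiniteMeasure : Measure G.PathSpace) = (μ : Measure G.PathSpace).real C :=
    integral_indicator_one hcl.isOpen.measurableSet
  rw [hμC, ← tendsto_add_atTop_iff_nat m] at hlim
  refine tendsto_nhds_unique hlim ?_
  have hseq : ∀ j, ∫ ω, BoundedContinuousFunction.indicator C hcl ω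
      ∂((G.weightedDist (j + m)).map (G.embed (k := j + m)) : Measure G.PathSpace) =
      G.wInit (x 0) * (∏ n ∈ Finset.range m, (a⁻¹ • G.M) (x n) (x (n + 1))) *
        ((a⁻¹ • G.M) ^ j *ᵥ G.wFinal) (x m) / (a⁻¹ ^ (j + m) * G.Z (j + m)) := by
    intro j
    rw [G.integral_map_weightedDist _ _ (by fun_prop : Continuous _).stronglyMeasurable,
      ← inv_pow_mul_pow_mulVec]
    have h1 := G.sum_weight_cylinder m j x
    rw [add_comm m j] at h1
    have h2 : ∀ y : G.Path (j + m), (G.weight y / G.Z (j + m)) •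
        BoundedContinuousFunction.indicator C hcl (G.embed y) =
        (G.weight y * (if ∀ n ≤ m, (G.embed y).vertex n = some (x n) then 1 else 0)) /
          G.Z (j + m) := by
      intro y
      rw [smul_eq_mul, div_mul_eq_mul_div, BoundedContinuousFunction.indicator_apply,
        Set.indicator_apply]
      rfl
    simp only [h2]
    rw [← Finset.sum_div, h1]
    simp only [Matrix.smul_apply, smul_eq_mul, Finset.prod_mul_distrib, Finset.prod_const,
      Finset.card_range, pow_add]
    have ha' := ha.ne'
    field_simp
  simp only [hseq]
  have h3 := ((tendsto_pi_nhds.1 (hP.tendsto_pow_mulVec G.wFinal) (x m)).const_mul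
    (G.wInit (x 0) * (∏ n ∈ Finset.range m, (a⁻¹ • G.M) (x n) (x (n + 1))))).div
    ((tendsto_add_atTop_iff_nat m).2 (tendsto_inv_pow_mul_Z hP)) (mul_pos hl hr).ne'
  rw [Pi.smul_apply, smul_eq_mul, mul_left_comm, mul_div_mul_left _ _ hl.ne'] at h3
  exact h3

/-- The event is covered by finitely many histories, so one of them has positive mass. -/
theorem exists_cylinder_ne_zero {μ : ProbabilityMeasure G.PathSpace} {n : ℕ} {i : Fin N}
    (h : (μ : Measure G.PathSpace) {ω | ω.vertex n = some i} ≠ 0) :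
    ∃ x : ℕ → Fin N, x n = i ∧
      (μ : Measure G.PathSpace) {ω | ∀ p ≤ n, ω.vertex p = some (x p)} ≠ 0 := by
  set ext : (Fin (n + 1) → Fin N) → ℕ → Fin N := fun y p =>
    if hp : p < n + 1 then y ⟨p, hp⟩ else i with hext
  have hback : ∀ (ω : G.PathSpace) (d p : ℕ), p + d = n → ω.vertex n = some i →
      ω.vertex p ≠ none := by
    intro ω d
    induction d with
    | zero => intro p hp hω; rw [show p = n by omega, hω]; simp
    | succ d ih =>
      intro p hp hω
      obtain ⟨j, hj⟩ := Option.ne_none_iff_exists'.1 (ih (p + 1) (by omega) hω)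
      obtain ⟨i', hi', -⟩ := ω.edge p j hj
      rw [hi']; simp
  have hsub : {ω : G.PathSpace | ω.vertex n = some i} ⊆
      ⋃ y : Fin (n + 1) → Fin N, {ω | ω.vertex n = some i} ∩
        {ω | ∀ p ≤ n, ω.vertex p = some (ext y p)} := by
    intro ω hω
    have hs : ∀ p : Fin (n + 1), ∃ j, ω.vertex p = some j := fun p =>
      Option.ne_none_iff_exists'.1 (hback ω (n - p) p (by omega) hω)
    choose y hy using hs
    refine Set.mem_iUnion.2 ⟨y, hω, fun p hp => ?_⟩
    simp only [hext, dif_pos (Nat.lt_succ_of_le hp)]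
    exact hy ⟨p, Nat.lt_succ_of_le hp⟩
  have : ∃ y : Fin (n + 1) → Fin N, (μ : Measure G.PathSpace) ({ω | ω.vertex n = some i} ∩
      {ω | ∀ p ≤ n, ω.vertex p = some (ext y p)}) ≠ 0 := by
    by_contra! hcon
    exact h (measure_mono_null hsub (measure_iUnion_null hcon))
  obtain ⟨y, hy⟩ := this
  obtain ⟨ω, hω1, hω2⟩ := nonempty_of_measure_ne_zero hy
  refine ⟨ext y, ?_, fun h0 => hy (measure_mono_null Set.inter_subset_right h0)⟩
  exact Option.some.inj ((hω2 n le_rfl).symm.trans hω1)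

/-- `IsTransitionMatrix` determines `P` only on rows of reachable states; there it is found by
comparing a charged cylinder with its one-step extensions. -/
theorem transition_eq (ha : 0 < a) (hP : IsPerronData (a⁻¹ • G.M) r l)
    (hr : 0 < G.wInit ⬝ᵥ r) (hl : 0 < l ⬝ᵥ G.wFinal) {μ : ProbabilityMeasure G.PathSpace}
    (hμ : G.IsLimitWeightedMeasure μ) {P : Matrix (Fin N) (Fin N) ℝ}
    (hPt : G.IsTransitionMatrix μ P) {i : Fin N} {n : ℕ}
    (hi : (μ : Measure G.PathSpace) {ω | ω.vertex n = some i} ≠ 0) :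
    r i ≠ 0 ∧ ∀ j, r i * P i j = (a⁻¹ • G.M) i j * r j := by
  obtain ⟨x, rfl, hx⟩ := exists_cylinder_ne_zero hi
  have hne := hx
  rw [← measureReal_ne_zero_iff, measure_cylinder ha hP hr hl hμ] at hne
  refine ⟨fun h0 => hne (by rw [h0, mul_zero, zero_div]), fun j => ?_⟩
  set x' := Function.update x (n + 1) j with hx'
  have hle : ∀ p, p ≤ n → x' p = x p := fun p hp => Function.update_of_ne (by omega) _ _
  have hnew : x' (n + 1) = j := Function.update_self _ _ _
  have h1 := congrArg ENNReal.toReal (hPt.2.2 n x')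
  rw [ENNReal.toReal_mul, ENNReal.toReal_ofReal (hPt.1 _ _)] at h1
  change (μ : Measure G.PathSpace).real _ = (μ : Measure G.PathSpace).real _ * _ at h1
  rw [measure_cylinder ha hP hr hl hμ, measure_cylinder ha hP hr hl hμ, Finset.prod_range_succ,
    hnew, hle n le_rfl, hle 0 (Nat.zero_le n), Finset.prod_congr rfl (fun p hp => by
      rw [hle p (Finset.mem_range.1 hp).le, hle (p + 1) (Finset.mem_range.1 hp)])] at h1
  set q := ∏ p ∈ Finset.range n, (a⁻¹ • G.M) (x p) (x (p + 1))
  have hq : G.wInit (x 0) * q / (G.wInit ⬝ᵥ r) ≠ 0 := fun h0 => hne (by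
    rw [mul_div_right_comm, h0, zero_mul])
  refine mul_left_cancel₀ hq ?_
  linear_combination -h1

theorem stationary_eq (ha : 0 < a) (hP : IsPerronData (a⁻¹ • G.M) r l)
    (hr : 0 < G.wInit ⬝ᵥ r) (hl : 0 < l ⬝ᵥ G.wFinal) {μ : ProbabilityMeasure G.PathSpace}
    (hμ : G.IsLimitWeightedMeasure μ) {π : Fin N → ℝ} (hπ : G.IsStationaryMeasure μ π)
    (j : Fin N) : π j = l j * r j := by
  obtain ⟨-, hsum, hreach, P, hPt, hst⟩ := hπ
  refine hP.stationary_eq hsum (fun i hi => ?_) hst j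
  obtain ⟨n, hn⟩ := hreach i hi
  exact transition_eq ha hP hr hl hμ hPt hn

end CWG

/-! ### Poisson equation and asymptotic variance. -/

namespace IsPerronData

variable {N : ℕ} {A : Matrix (Fin N) (Fin N) ℝ} {r l : Fin N → ℝ}

/-- The Poisson equation is solvable as soon as its right-hand side has mean zero. -/
theorem exists_sub_mulVec_eq (h : IsPerronData A r l) {b : Fin N → ℝ} (hb : l ⬝ᵥ b = 0) :
    ∃ u : Fin N → ℝ, u - A *ᵥ u = b := by
  -- Adding the projection makes `1 - A` invertible: `T` preserves `l ⬝ᵥ x`, so a kernel vector is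
  -- fixed by `A` and killed by `l`, hence equals `lim Aⁿ x = 0`.
  set T := Matrix.toLin' (1 - A + vecMulVec r l) with hT
  have hTx : ∀ x, T x = x - A *ᵥ x + (l ⬝ᵥ x) • r := by
    intro x
    rw [hT, Matrix.toLin'_apply, add_mulVec, sub_mulVec, one_mulVec, vecMulVec_mulVec,
      op_smul_eq_smul]
  have hlT : ∀ x, l ⬝ᵥ T x = l ⬝ᵥ x := by
    intro x
    rw [hTx, dotProduct_add, dotProduct_sub, dotProduct_mulVec, h.left_vecMul, dotProduct_smul,
      h.dotProduct_eq]
    simp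
  have hinj : Function.Injective T := by
    rw [← LinearMap.ker_eq_bot, LinearMap.ker_eq_bot']
    intro x hx
    have hl0 : l ⬝ᵥ x = 0 := by rw [← hlT, hx, dotProduct_zero]
    have hA : A *ᵥ x = x := by
      rw [hTx, hl0, zero_smul, add_zero, sub_eq_zero] at hx
      exact hx.symm
    have hpow : ∀ n : ℕ, A ^ n *ᵥ x = x := by
      intro n
      induction n with
      | zero => simp
      | succ n ih => rw [pow_succ, ← mulVec_mulVec, hA, ih]
    have := h.tendsto_pow_mulVec x
    simp only [hpow, hl0, zero_smul] at this
    exact tendsto_nhds_unique tendsto_const_nhds this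
  obtain ⟨u, hu⟩ := LinearMap.injective_iff_surjective.1 hinj b
  refine ⟨u, ?_⟩
  have hl0 : l ⬝ᵥ u = 0 := by rw [← hlT, hu, hb]
  rw [← hu, hTx, hl0, zero_smul, add_zero]

/-- Solutions of a Poisson equation vanish where the right eigenvector does. -/
theorem eq_zero_of_right_eq_zero (h : IsPerronData A r l) {f u : Fin N → ℝ}
    (hu : ∀ i, u i = ∑ j, A i j * (u j + f j * r j)) {i : Fin N} (hi : r i = 0) : u i = 0 := by
  -- The zero set of `r` is closed under transitions, so there `u = Aⁿ u`, which tends to `(l ⬝ᵥ u)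
  -- r = 0`.
  have hA : ∀ i, r i = 0 → ∀ j, A i j ≠ 0 → r j = 0 := by
    intro i hi j hij
    by_contra hj
    exact (h.right_pos_of_pos (lt_of_le_of_ne (h.nonneg i j) (Ne.symm hij))
      (lt_of_le_of_ne (h.right_nonneg j) (Ne.symm hj))).ne' hi
  have hpow : ∀ (n : ℕ) i, r i = 0 → (A ^ n *ᵥ u) i = u i := by
    intro n
    induction n with
    | zero => simp
    | succ n ih =>
      intro i hi
      rw [pow_succ', ← mulVec_mulVec, hu i]
      simp only [mulVec, dotProduct]
      refine Finset.sum_congr rfl fun j _ => ?_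
      by_cases hij : A i j = 0
      · simp [hij]
      · have hj := hA i hi j hij
        have := ih j hj
        simp only [mulVec, dotProduct] at this
        rw [this, hj, mul_zero, add_zero]
  have hlim := tendsto_pi_nhds.1 (h.tendsto_pow_mulVec u) i
  simp only [hpow _ i hi, Pi.smul_apply, hi, smul_zero] at hlim
  exact tendsto_nhds_unique tendsto_const_nhds hlim

end IsPerronData

/-- The variance formula for the martingale differences given by a solution `h` of the Poisson
equation, in terms of the law `Q` of two consecutive states. -/
theorem sum_mul_sq_eq_of_poisson {ι : Type*} [Fintype ι] {Q : ι → ι → ℝ} {π φ h : ι → ℝ}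
    (hrow : ∀ i, ∑ j, Q i j = π i) (hcol : ∀ j, ∑ i, Q i j = π j)
    (hh : ∀ i, π i * h i = ∑ j, Q i j * (φ j + h j)) :
    ∑ i, ∑ j, Q i j * (φ j + h j - h i) ^ 2 = ∑ i, π i * (φ i ^ 2 + 2 * φ i * h i) := by
  have e1 : ∑ i, ∑ j, Q i j * (φ j + h j) ^ 2 = ∑ j, π j * (φ j + h j) ^ 2 := by
    rw [Finset.sum_comm]
    refine Finset.sum_congr rfl fun j _ => ?_
    rw [← Finset.sum_mul, hcol]
  have e2 : ∑ i, ∑ j, Q i j * (2 * (φ j + h j) * h i) = ∑ i, 2 * π i * h i ^ 2 := by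
    refine Finset.sum_congr rfl fun i _ => ?_
    have : ∀ j, Q i j * (2 * (φ j + h j) * h i) = 2 * h i * (Q i j * (φ j + h j)) := fun j => by
      ring
    simp only [this]
    rw [← Finset.mul_sum, ← hh]
    ring
  have e3 : ∑ i, ∑ j, Q i j * h i ^ 2 = ∑ i, π i * h i ^ 2 := by
    refine Finset.sum_congr rfl fun i _ => ?_
    rw [← Finset.sum_mul, hrow]
  have e4 : ∀ i j, Q i j * (φ j + h j - h i) ^ 2 = Q i j * (φ j + h j) ^ 2 -
      Q i j * (2 * (φ j + h j) * h i) + Q i j * h i ^ 2 := fun i j => by ring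
  simp only [e4, Finset.sum_add_distrib, Finset.sum_sub_distrib]
  rw [e1, e2, e3, ← Finset.sum_sub_distrib, ← Finset.sum_add_distrib]
  exact Finset.sum_congr rfl fun i _ => by ring

/-- The asymptotic variance vanishes exactly when the observable is a coboundary. -/
theorem sum_mul_sq_eq_zero_iff_coboundary {ι : Type*} [Fintype ι] {Q : ι → ι → ℝ} {π φ h : ι → ℝ}
    (hQ : ∀ i j, 0 ≤ Q i j) (hrow : ∀ i, ∑ j, Q i j = π i) (hcol : ∀ j, ∑ i, Q i j = π j)
    (hh : ∀ i, π i * h i = ∑ j, Q i j * (φ j + h j)) :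
    ∑ i, ∑ j, Q i j * (φ j + h j - h i) ^ 2 = 0 ↔
      ∃ g : ι → ℝ, ∀ i j, 0 < Q i j → φ i = g i - g j := by
  have hzero : ∀ k : ι → ι → ℝ, ∑ i, ∑ j, Q i j * k i j ^ 2 = 0 ↔
      ∀ i j, 0 < Q i j → k i j = 0 := by
    intro k
    have hnn : ∀ i j, 0 ≤ Q i j * k i j ^ 2 := fun i j => mul_nonneg (hQ i j) (sq_nonneg _)
    rw [Finset.sum_eq_zero_iff_of_nonneg fun i _ => Finset.sum_nonneg fun j _ => hnn i j]
    simp only [Finset.mem_univ, true_imp_iff]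
    refine forall_congr' fun i => ?_
    rw [Finset.sum_eq_zero_iff_of_nonneg fun j _ => hnn i j]
    simp only [Finset.mem_univ, true_imp_iff, mul_eq_zero]
    refine forall_congr' fun j => ⟨fun h0 hpos => ?_, fun h0 => ?_⟩
    · exact pow_eq_zero_iff two_ne_zero |>.1 (h0.resolve_left hpos.ne')
    · rcases (hQ i j).eq_or_lt with hq | hq
      · exact Or.inl hq.symm
      · exact Or.inr (by rw [h0 hq]; ring)
  rw [hzero fun i j => φ j + h j - h i]
  constructor
  · intro h0
    exact ⟨fun i => φ i + h i, fun i j hij => by linarith [h0 i j hij]⟩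
  · rintro ⟨g, hg⟩
    -- `g - φ` also solves the Poisson equation, so `δ` is harmonic; the variance formula with `φ =
    -- 0` makes `δ` constant along edges.
    set δ : ι → ℝ := fun i => h i - (g i - φ i) with hδ
    have hδh : ∀ i, π i * δ i = ∑ j, Q i j * ((fun _ => (0 : ℝ)) j + δ j) := by
      intro i
      have hterm : ∀ j, Q i j * (0 + δ j) = Q i j * (φ j + h j) - Q i j * (g i - φ i) := by
        intro j
        rcases (hQ i j).eq_or_lt with hq | hq
        · simp [← hq]
        · simp only [hδ]
          linear_combination (-Q i j) * hg i j hq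
      simp only [hterm]
      rw [Finset.sum_sub_distrib, ← hh, ← Finset.sum_mul, hrow]
      simp only [hδ]
      ring
    have h1 := sum_mul_sq_eq_of_poisson hrow hcol hδh
    have h2 := (hzero fun i j => 0 + δ j - δ i).1 (by rw [h1]; simp)
    intro i j hij
    have h3 := h2 i j hij
    have h4 := hg i j hij
    simp only [hδ] at h3
    linarith

/-! ### Twisted matrices at small frequencies. -/

/-- The matrix `A` twisted by the characters `exp (i s f)`. -/
noncomputable def twistedMatrix {N : ℕ} (A : Matrix (Fin N) (Fin N) ℝ) (f : Fin N → ℝ) (s : ℝ) :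
    Matrix (Fin N) (Fin N) ℂ :=
  of fun i j => (A i j : ℂ) * Complex.exp (s * f j * Complex.I)

namespace IsPerronData

variable {N : ℕ} {A : Matrix (Fin N) (Fin N) ℝ} {r l : Fin N → ℝ}

theorem norm_twistedMatrix_pow_mulVec_le (hA : ∀ i j, 0 ≤ A i j) (f : Fin N → ℝ) (s : ℝ)
    {v : Fin N → ℂ} {c : ℝ} (hv : ∀ i, ‖v i‖ ≤ c) (n : ℕ) :
    ∀ i, ‖(twistedMatrix A f s ^ n *ᵥ v) i‖ ≤ (A ^ n *ᵥ fun _ => c) i := by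
  induction n with
  | zero => simpa using hv
  | succ n ih =>
    intro i
    rw [pow_succ', pow_succ', ← mulVec_mulVec, ← mulVec_mulVec, mulVec, mulVec, dotProduct,
      dotProduct]
    refine (norm_sum_le _ _).trans (Finset.sum_le_sum fun j _ => ?_)
    have : ‖twistedMatrix A f s i j‖ = A i j := by
      simp only [twistedMatrix, of_apply, norm_mul, Complex.norm_real, Real.norm_eq_abs,
        abs_of_nonneg (hA i j)]
      rw [← Complex.ofReal_mul, Complex.norm_exp_ofReal_mul_I, mul_one]
    rw [norm_mul, this]
    exact mul_le_mul_of_nonneg_left (ih j) (hA i j)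

/-- Twisting preserves the moduli of the entries, so the bounded sequence `Aⁿ 1` dominates uniformly
in `s`. -/
theorem exists_norm_twistedMatrix_pow_mulVec_le (h : IsPerronData A r l) (f : Fin N → ℝ) :
    ∃ C : ℝ, 0 ≤ C ∧ ∀ (s : ℝ) (n : ℕ) (v : Fin N → ℂ),
      ‖twistedMatrix A f s ^ n *ᵥ v‖ ≤ C * ‖v‖ := by
  obtain ⟨C, hC⟩ := (h.tendsto_pow_mulVec fun _ => 1).norm.bddAbove_range
  have hC' : ∀ n : ℕ, ‖A ^ n *ᵥ fun _ => (1 : ℝ)‖ ≤ C := fun n => hC ⟨n, rfl⟩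
  have hC0 : 0 ≤ C := (norm_nonneg _).trans (hC' 0)
  refine ⟨C, hC0, fun s n v => ?_⟩
  rw [pi_norm_le_iff_of_nonneg (mul_nonneg hC0 (norm_nonneg v))]
  intro i
  refine (norm_twistedMatrix_pow_mulVec_le h.nonneg f s (fun i => norm_le_pi_norm v i) n i).trans ?_
  have : (fun _ : Fin N => ‖v‖) = ‖v‖ • fun _ => (1 : ℝ) := by ext; simp
  rw [this, mulVec_smul, Pi.smul_apply, smul_eq_mul, mul_comm]
  exact mul_le_mul_of_nonneg_right
    (((le_abs_self _).trans (norm_le_pi_norm (A ^ n *ᵥ fun _ => (1 : ℝ)) i)).trans (hC' n)) (norm_nonneg v)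

/-- Telescoping: each of the `n` steps costs one eigenvector defect, amplified at most by `C`. -/
theorem norm_pow_mulVec_sub_pow_smul_le {B : Matrix (Fin N) (Fin N) ℂ} {C : ℝ}
    (hB : ∀ (n : ℕ) (v : Fin N → ℂ), ‖B ^ n *ᵥ v‖ ≤ C * ‖v‖) {c : ℂ} (hc : ‖c‖ ≤ 1)
    (x : Fin N → ℂ) (n : ℕ) :
    ‖B ^ n *ᵥ x - c ^ n • x‖ ≤ n * (C * ‖B *ᵥ x - c • x‖) := by
  induction n with
  | zero => simp
  | succ n ih =>
    have : B ^ (n + 1) *ᵥ x - c ^ (n + 1) • x =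
        B ^ n *ᵥ (B *ᵥ x - c • x) + c • (B ^ n *ᵥ x - c ^ n • x) := by
      rw [mulVec_sub, mulVec_mulVec, mulVec_smul, smul_sub, smul_smul, pow_succ, pow_succ']
      abel
    rw [this]
    refine (norm_add_le _ _).trans ?_
    rw [norm_smul]
    have h1 := mul_le_mul hc ih (norm_nonneg _) zero_le_one
    have h2 := hB n (B *ᵥ x - c • x)
    push_cast
    linarith

theorem exp_mul_quadratic_sub_isBigO (f r u v : ℝ) :
    (fun s : ℝ => Complex.exp (s * f * Complex.I) * (r + s * u * Complex.I - s ^ 2 / 2 * v) -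
      (r + s * (u + f * r) * Complex.I - s ^ 2 / 2 * (v + 2 * f * u + f ^ 2 * r)))
      =O[𝓝 0] fun s : ℝ => s ^ 3 := by
  have hlin : Tendsto (fun s : ℝ => (s * f * Complex.I : ℂ)) (𝓝 0) (𝓝 0) := by
    have : Continuous fun s : ℝ => (s * f * Complex.I : ℂ) := by fun_prop
    simpa using this.tendsto 0
  have hR := (Complex.exp_sub_sum_range_isBigO_pow 3).comp_tendsto hlin
  have hR' : (fun s : ℝ => Complex.exp (s * f * Complex.I) -
      (1 + s * f * Complex.I - s ^ 2 * f ^ 2 / 2)) =O[𝓝 0] fun s : ℝ => s ^ 3 := by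
    refine (hR.congr_left fun s => ?_).trans ?_
    · simp only [Function.comp_apply, Finset.sum_range_succ, Finset.sum_range_zero]
      norm_num
      linear_combination ((1 / 2 : ℂ) * s ^ 2 * f ^ 2) * Complex.I_sq
    · refine Asymptotics.IsBigO.of_bound (|f| ^ 3) (Eventually.of_forall fun s => ?_)
      simp [mul_pow, mul_comm]
  have hq : (fun s : ℝ => (r + s * u * Complex.I - s ^ 2 / 2 * v : ℂ)) =O[𝓝 0]
      fun _ : ℝ => (1 : ℝ) := by
    have : Continuous fun s : ℝ => (r + s * u * Complex.I - s ^ 2 / 2 * v : ℂ) := by fun_prop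
    exact (this.tendsto 0).isBigO_one ℝ
  -- The terms of degree 3 and 4 in the product of the two quadratic polynomials.
  have hp : (fun s : ℝ => (s : ℂ) ^ 3 * (-(f * v + f ^ 2 * u) / 2 * Complex.I +
      s * f ^ 2 * v / 4)) =O[𝓝 0] fun s : ℝ => s ^ 3 := by
    have hc : Continuous fun s : ℝ => (-(f * v + f ^ 2 * u) / 2 * Complex.I +
      s * f ^ 2 * v / 4 : ℂ) := by fun_prop
    have h1 := (Asymptotics.IsBigO.of_bound 1 (Eventually.of_forall fun s : ℝ => by simp) :
      (fun s : ℝ => (s : ℂ) ^ 3) =O[𝓝 0] fun s : ℝ => s ^ 3).mul ((hc.tendsto 0).isBigO_one ℝ)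
    simpa using h1
  have hsum := (hR'.mul hq).add (hp.trans (Asymptotics.isBigO_of_le _ fun s => by simp) :
    _ =O[𝓝 0] fun s : ℝ => s ^ 3 * 1)
  refine (hsum.congr_left fun s => ?_).congr_right fun s => mul_one _
  linear_combination (-(s : ℂ) ^ 2 * f * u) * Complex.I_sq

end IsPerronData

namespace IsPerronData

variable {N : ℕ} {A : Matrix (Fin N) (Fin N) ℝ} {r l : Fin N → ℝ}

/-- A second order approximate eigenvector of the twisted matrix. -/
noncomputable def approxEigenvector (r u v : Fin N → ℝ) (s : ℝ) : Fin N → ℂ :=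
  fun j => r j + s * u j * Complex.I - s ^ 2 / 2 * v j

/-- The three hypotheses are the eigenvector equation for the eigenvalue `1 - σ s² / 2` at orders
`0`, `1` and `2` in `s`. -/
theorem approxEigenvector_isBigO {f u v : Fin N → ℝ} {σ : ℝ} (hr : ∀ i, r i = ∑ j, A i j * r j)
    (hu : ∀ i, u i = ∑ j, A i j * (u j + f j * r j))
    (hv : ∀ i, v i + σ * r i = ∑ j, A i j * (v j + 2 * f j * u j + f j ^ 2 * r j)) :
    (fun s : ℝ => twistedMatrix A f s *ᵥ approxEigenvector r u v s -
      (1 - σ * s ^ 2 / 2 : ℂ) • approxEigenvector r u v s) =O[𝓝 0] fun s : ℝ => s ^ 3 := by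
  rw [Asymptotics.isBigO_pi]
  intro i
  have h1 : (fun s : ℝ => ∑ j, (A i j : ℂ) * (Complex.exp (s * f j * Complex.I) *
      (r j + s * u j * Complex.I - s ^ 2 / 2 * v j) - (r j + s * (u j + f j * r j) * Complex.I -
        s ^ 2 / 2 * (v j + 2 * f j * u j + f j ^ 2 * r j)))) =O[𝓝 0] fun s : ℝ => s ^ 3 :=
    Asymptotics.IsBigO.fun_sum fun j _ =>
      (exp_mul_quadratic_sub_isBigO (f j) (r j) (u j) (v j)).const_mul_left _
  have h2 : (fun s : ℝ => (s : ℂ) ^ 3 * (σ * u i / 2 * Complex.I - s * σ * v i / 4)) =O[𝓝 0]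
      fun s : ℝ => s ^ 3 := by
    have hc : Continuous fun s : ℝ => (σ * u i / 2 * Complex.I - s * σ * v i / 4 : ℂ) := by
      fun_prop
    have h3 := (Asymptotics.IsBigO.of_bound 1 (Eventually.of_forall fun s : ℝ => by simp) :
      (fun s : ℝ => (s : ℂ) ^ 3) =O[𝓝 0] fun s : ℝ => s ^ 3).mul ((hc.tendsto 0).isBigO_one ℝ)
    simpa using h3
  refine (h1.add h2).congr_left fun s => ?_
  have er : (r i : ℂ) = ∑ j, (A i j : ℂ) * r j := by exact_mod_cast congrArg Complex.ofReal (hr i)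
  have eu : (u i : ℂ) = ∑ j, (A i j : ℂ) * (u j + f j * r j) := by
    exact_mod_cast congrArg Complex.ofReal (hu i)
  have ev : (v i + σ * r i : ℂ) = ∑ j, (A i j : ℂ) * (v j + 2 * f j * u j + f j ^ 2 * r j) := by
    exact_mod_cast congrArg Complex.ofReal (hv i)
  have hsplit : ∑ j, (A i j : ℂ) * (Complex.exp (s * f j * Complex.I) *
      (r j + s * u j * Complex.I - s ^ 2 / 2 * v j) - (r j + s * (u j + f j * r j) * Complex.I -
        s ^ 2 / 2 * (v j + 2 * f j * u j + f j ^ 2 * r j))) =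
      (∑ j, (A i j : ℂ) * Complex.exp (s * f j * Complex.I) *
        (r j + s * u j * Complex.I - s ^ 2 / 2 * v j)) -
      (r i + s * Complex.I * u i - s ^ 2 / 2 * (v i + σ * r i)) := by
    rw [ev, er, eu, Finset.mul_sum, Finset.mul_sum, ← Finset.sum_add_distrib,
      ← Finset.sum_sub_distrib, ← Finset.sum_sub_distrib]
    exact Finset.sum_congr rfl fun j _ => by ring
  rw [hsplit]
  simp only [Pi.sub_apply, Pi.smul_apply, smul_eq_mul, mulVec, dotProduct, twistedMatrix,
    of_apply, approxEigenvector]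
  ring

theorem continuous_twistedMatrix (A : Matrix (Fin N) (Fin N) ℝ) (f : Fin N → ℝ) :
    Continuous (twistedMatrix A f) := by
  refine continuous_pi fun i => continuous_pi fun j => ?_
  simp only [twistedMatrix, of_apply]
  fun_prop

theorem twistedMatrix_zero (A : Matrix (Fin N) (Fin N) ℝ) (f : Fin N → ℝ) :
    twistedMatrix A f 0 = A.map (algebraMap ℝ ℂ) := by
  ext i j
  simp [twistedMatrix]

theorem twistedMatrix_zero_pow_mulVec (A : Matrix (Fin N) (Fin N) ℝ) (f v : Fin N → ℝ) (n : ℕ) :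
    twistedMatrix A f 0 ^ n *ᵥ (fun i => (v i : ℂ)) = fun i => (((A ^ n *ᵥ v) i : ℝ) : ℂ) := by
  have : (A.map (algebraMap ℝ ℂ)) ^ n = (A ^ n).map (algebraMap ℝ ℂ) :=
    ((algebraMap ℝ ℂ).mapMatrix.map_pow A n).symm
  rw [twistedMatrix_zero, this]
  ext i
  simp [mulVec, dotProduct]

/-- The powers of the twisted matrix, at frequencies tending to zero, send to zero the vectors on
which the left eigenvector vanishes. -/
theorem tendsto_twistedMatrix_pow_mulVec_zero (h : IsPerronData A r l) (f : Fin N → ℝ)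
    {s : ℕ → ℝ} (hs : Tendsto s atTop (𝓝 0)) {w : Fin N → ℝ} (hw : l ⬝ᵥ w = 0) :
    Tendsto (fun n => twistedMatrix A f (s n) ^ n *ᵥ (fun i => (w i : ℂ))) atTop (𝓝 0) := by
  obtain ⟨C, hC0, hC⟩ := h.exists_norm_twistedMatrix_pow_mulVec_le f
  set w' : Fin N → ℂ := fun i => w i with hw'
  have hA : Tendsto (fun m => C * ‖twistedMatrix A f 0 ^ m *ᵥ w'‖) atTop (𝓝 0) := by
    have h1 := h.tendsto_pow_mulVec w
    rw [hw, zero_smul] at h1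
    have h2 : Tendsto (fun m => twistedMatrix A f 0 ^ m *ᵥ w') atTop (𝓝 0) := by
      simp only [hw', twistedMatrix_zero_pow_mulVec]
      refine tendsto_pi_nhds.2 fun i => ?_
      have := (Complex.continuous_ofReal.tendsto _).comp (tendsto_pi_nhds.1 h1 i)
      simpa [Function.comp_def] using this
    simpa using h2.norm.const_mul C
  rw [tendsto_zero_iff_norm_tendsto_zero]
  refine tendsto_order.2 ⟨fun ε hε => Eventually.of_forall fun n => hε.trans_le (norm_nonneg _),
    fun ε hε => ?_⟩
  -- Fix `m` making the untwisted image small; continuity handles the twist in `m` factors, the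
  -- uniform bound the other `n - m`.
  obtain ⟨m, hm⟩ := (hA.eventually_lt_const hε).exists
  have hcont : Continuous fun x : ℝ => C * ‖twistedMatrix A f x ^ m *ᵥ w'‖ :=
    continuous_const.mul (Continuous.matrix_mulVec ((continuous_twistedMatrix A f).pow m)
      continuous_const).norm
  have hlt := ((hcont.tendsto 0).comp hs).eventually_lt_const hm
  filter_upwards [hlt, eventually_ge_atTop m] with n hn hmn
  refine lt_of_le_of_lt ?_ hn
  obtain ⟨d, rfl⟩ := Nat.exists_eq_add_of_le' hmn
  rw [pow_add, ← mulVec_mulVec]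
  exact hC _ _ _

/-- The twisted powers of the right eigenvector at frequencies of order `n ^ (-1/2)`. -/
theorem tendsto_twistedMatrix_pow_mulVec_right (h : IsPerronData A r l) {f u v : Fin N → ℝ}
    {σ : ℝ} (hσ : 0 ≤ σ) (hu : ∀ i, u i = ∑ j, A i j * (u j + f j * r j))
    (hv : ∀ i, v i + σ * r i = ∑ j, A i j * (v j + 2 * f j * u j + f j ^ 2 * r j))
    {s : ℕ → ℝ} {τ : ℝ} (hs : Tendsto s atTop (𝓝 0))
    (hsτ : Tendsto (fun n : ℕ => n * s n ^ 2) atTop (𝓝 τ)) :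
    Tendsto (fun n => twistedMatrix A f (s n) ^ n *ᵥ (fun i => (r i : ℂ))) atTop
      (𝓝 (Complex.exp (-(σ * τ / 2)) • fun i => (r i : ℂ))) := by
  obtain ⟨C, hC0, hC⟩ := h.exists_norm_twistedMatrix_pow_mulVec_le f
  set q := approxEigenvector r u v
  set r' : Fin N → ℂ := fun i => r i with hr'
  have hq : Tendsto (fun n => q (s n)) atTop (𝓝 r') := by
    have hc : Continuous q := by
      refine continuous_pi fun i => ?_
      simp only [q, approxEigenvector]
      fun_prop
    have h0 : q 0 = r' := by ext i; simp [q, approxEigenvector, hr']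
    rw [← h0]
    exact (hc.tendsto 0).comp hs
  set c : ℕ → ℂ := fun n => 1 - σ * s n ^ 2 / 2 with hc
  have hO := (approxEigenvector_isBigO (A := A) (fun i => (congrFun h.mulVec_right i).symm) hu hv)
  obtain ⟨K, hK⟩ := (hO.comp_tendsto hs).bound
  have hcn : Tendsto (fun n => c n ^ n) atTop (𝓝 (Complex.exp (-(σ * τ / 2)))) := by
    have h1 : Tendsto (fun n : ℕ => (n : ℂ) * (-(σ * s n ^ 2 / 2))) atTop
        (𝓝 (-(σ * τ / 2) : ℂ)) := by
      have h2 := ((Complex.continuous_ofReal.tendsto _).comp hsτ).const_mul (-(σ / 2) : ℂ)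
      have h3 : (-(σ * τ / 2) : ℂ) = -(σ / 2) * τ := by ring
      rw [h3]
      refine h2.congr fun n => ?_
      simp only [Function.comp_apply]
      push_cast
      ring
    simpa [hc, sub_eq_add_neg] using Complex.tendsto_one_add_pow_exp_of_tendsto h1
  have hc1 : ∀ᶠ n in atTop, ‖c n‖ ≤ 1 := by
    have h1 : Tendsto (fun n => σ * s n ^ 2 / 2) atTop (𝓝 0) := by
      simpa using ((hs.pow 2).const_mul σ).div_const 2
    filter_upwards [h1.eventually_lt_const one_pos] with n hn
    have h2 : c n = ((1 - σ * s n ^ 2 / 2 : ℝ) : ℂ) := by simp [hc]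
    rw [h2, Complex.norm_real, Real.norm_eq_abs, abs_le]
    constructor <;> nlinarith [mul_nonneg hσ (sq_nonneg (s n))]
  have hdiff : Tendsto (fun n => twistedMatrix A f (s n) ^ n *ᵥ q (s n) - c n ^ n • q (s n))
      atTop (𝓝 0) := by
    -- `n` defects of size `O(|s n|³)`.
    have hlim : Tendsto (fun n : ℕ => C * K * ((n * s n ^ 2) * |s n|)) atTop (𝓝 0) := by
      simpa using ((hsτ.mul hs.abs).const_mul (C * K))
    refine squeeze_zero_norm' ?_ hlim
    filter_upwards [hc1, hK] with n hn hKn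
    refine (norm_pow_mulVec_sub_pow_smul_le (hC (s n)) hn _ n).trans ?_
    have h1 := mul_le_mul_of_nonneg_left (mul_le_mul_of_nonneg_left hKn hC0) (Nat.cast_nonneg n)
    refine h1.trans (le_of_eq ?_)
    simp only [Function.comp_apply, norm_pow, Real.norm_eq_abs]
    rw [← sq_abs (s n)]
    ring
  have hqr : Tendsto (fun n => twistedMatrix A f (s n) ^ n *ᵥ (r' - q (s n))) atTop (𝓝 0) := by
    have h1 : Tendsto (fun n => C * ‖r' - q (s n)‖) atTop (𝓝 0) := by
      simpa using ((tendsto_const_nhds (x := r')).sub hq).norm.const_mul C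
    exact squeeze_zero_norm (fun n => hC _ _ _) h1
  have hall := (hdiff.add hqr).add (hcn.smul hq)
  rw [add_zero, zero_add] at hall
  refine hall.congr fun n => ?_
  rw [mulVec_sub]
  abel

/-- The central limit theorem for nonnegative matrices: asymptotics of the twisted powers. -/
theorem exists_variance (h : IsPerronData A r l) {f : Fin N → ℝ}
    (hf : ∑ i, l i * r i * f i = 0) :
    ∃ σ : ℝ, 0 ≤ σ ∧
      (σ = 0 ↔ ∃ g : Fin N → ℝ, ∀ i j, 0 < l i * A i j * r j → f i = g i - g j) ∧
      ∀ (s : ℕ → ℝ) (τ : ℝ), Tendsto s atTop (𝓝 0) →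
        Tendsto (fun n : ℕ => n * s n ^ 2) atTop (𝓝 τ) → ∀ w : Fin N → ℝ,
          Tendsto (fun n => twistedMatrix A f (s n) ^ n *ᵥ (fun i => (w i : ℂ))) atTop
            (𝓝 (fun i => Complex.exp (-(σ * τ / 2)) * ((l ⬝ᵥ w) * r i : ℝ))) := by
  have hlA : ∀ x, l ⬝ᵥ (A *ᵥ x) = l ⬝ᵥ x := fun x => by
    rw [dotProduct_mulVec, h.left_vecMul]
  obtain ⟨u, hu⟩ := h.exists_sub_mulVec_eq (b := A *ᵥ fun j => f j * r j) (by
    rw [hlA, ← hf]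
    exact Finset.sum_congr rfl fun i _ => by ring)
  have hu' : ∀ i, u i = ∑ j, A i j * (u j + f j * r j) := by
    intro i
    have h1 := congrFun hu i
    simp only [Pi.sub_apply, mulVec, dotProduct] at h1
    simp only [mul_add, Finset.sum_add_distrib]
    linarith
  set z : Fin N → ℝ := fun j => 2 * f j * u j + f j ^ 2 * r j with hz
  -- The only value for which the second-order equation satisfies the solvability condition of mean
  -- zero.
  set σ := l ⬝ᵥ z with hσ
  obtain ⟨v, hv⟩ := h.exists_sub_mulVec_eq (b := A *ᵥ z - σ • r) (by
    rw [dotProduct_sub, hlA, dotProduct_smul, h.dotProduct_eq, smul_eq_mul, mul_one, sub_self])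
  have hv' : ∀ i, v i + σ * r i = ∑ j, A i j * (v j + 2 * f j * u j + f j ^ 2 * r j) := by
    intro i
    have h1 := congrFun hv i
    simp only [Pi.sub_apply, Pi.smul_apply, smul_eq_mul, mulVec, dotProduct] at h1
    have h2 : ∑ j, A i j * (v j + 2 * f j * u j + f j ^ 2 * r j) =
        ∑ j, A i j * v j + ∑ j, A i j * z j := by
      rw [← Finset.sum_add_distrib]
      exact Finset.sum_congr rfl fun j _ => by simp only [hz]; ring
    linarith
  -- The default value `0` where `r i = 0` is harmless, since `u` vanishes there too.
  set k : Fin N → ℝ := fun i => u i / r i with hk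
  have hrk : ∀ i, r i * k i = u i := by
    intro i
    by_cases hi : r i = 0
    · rw [hi, zero_mul, h.eq_zero_of_right_eq_zero hu' hi]
    · exact mul_div_cancel₀ _ hi
  -- Law of two consecutive states of the stationary Doob chain.
  set Q : Fin N → Fin N → ℝ := fun i j => l i * A i j * r j with hQ
  have hQ0 : ∀ i j, 0 ≤ Q i j := fun i j =>
    mul_nonneg (mul_nonneg (h.left_nonneg i) (h.nonneg i j)) (h.right_nonneg j)
  have hrow : ∀ i, ∑ j, Q i j = l i * r i := by
    intro i
    have h1 := congrFun h.mulVec_right i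
    simp only [mulVec, dotProduct] at h1
    rw [← h1, Finset.mul_sum]
    exact Finset.sum_congr rfl fun j _ => mul_assoc _ _ _
  have hcol : ∀ j, ∑ i, Q i j = l j * r j := by
    intro j
    have h1 := congrFun h.left_vecMul j
    simp only [vecMul, dotProduct] at h1
    rw [← h1, Finset.sum_mul]
  have hpois : ∀ i, l i * r i * k i = ∑ j, Q i j * (f j + k j) := by
    intro i
    rw [mul_assoc, hrk, hu' i, Finset.mul_sum]
    refine Finset.sum_congr rfl fun j _ => ?_
    rw [← hrk j]
    simp only [hQ]
    ring
  have hσQ : σ = ∑ i, ∑ j, Q i j * (f j + k j - k i) ^ 2 := by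
    rw [sum_mul_sq_eq_of_poisson (π := fun i => l i * r i) hrow hcol hpois, hσ]
    refine Finset.sum_congr rfl fun i _ => ?_
    simp only [hz]
    rw [← hrk i]
    ring
  have hσ0 : 0 ≤ σ := by
    rw [hσQ]
    exact Finset.sum_nonneg fun i _ => Finset.sum_nonneg fun j _ =>
      mul_nonneg (hQ0 i j) (sq_nonneg _)
  refine ⟨σ, hσ0, ?_, fun s τ hs hsτ w => ?_⟩
  · rw [hσQ]
    exact sum_mul_sq_eq_zero_iff_coboundary hQ0 hrow hcol hpois
  · have h1 := h.tendsto_twistedMatrix_pow_mulVec_right hσ0 hu' hv' hs hsτ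
    -- Split `w` into its component along `r` and a vector killed by `l`.
    have h2 := h.tendsto_twistedMatrix_pow_mulVec_zero f hs (w := w - (l ⬝ᵥ w) • r) (by
      rw [dotProduct_sub, dotProduct_smul, h.dotProduct_eq, smul_eq_mul, mul_one, sub_self])
    have h3 := (h1.const_smul ((l ⬝ᵥ w : ℝ) : ℂ)).add h2
    have h4 : ((l ⬝ᵥ w : ℝ) : ℂ) • (Complex.exp (-(σ * τ / 2)) • fun i => (r i : ℂ)) + 0 =
        fun i => Complex.exp (-(σ * τ / 2)) * ((l ⬝ᵥ w) * r i : ℝ) := by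
      ext i
      simp only [Pi.add_apply, Pi.smul_apply, smul_eq_mul, Pi.zero_apply]
      push_cast
      ring
    rw [h4] at h3
    refine h3.congr fun n => ?_
    rw [← mulVec_smul, ← mulVec_add]
    congr 1
    ext i
    simp

end IsPerronData

/-! ### Characteristic functions and the limit theorem. -/

namespace CWG

variable {N : ℕ} (G : CWG N)

theorem isProbabilityMeasure_map_weightedDist {Y : Type*} [MeasurableSpace Y] {k : ℕ}
    (hZ : G.Z k ≠ 0) (φ : G.Path k → Y) :
    IsProbabilityMeasure ((G.weightedDist k).map φ : Measure Y) := by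
  have h1 := G.integral_map_weightedDist φ (fun _ => (1 : ℝ)) stronglyMeasurable_const
  rw [integral_const, smul_eq_mul, mul_one] at h1
  rw [isProbabilityMeasure_iff_real, h1]
  simp only [smul_eq_mul, mul_one]
  rw [← Finset.sum_div]
  exact div_self hZ

variable {G} {a : ℝ} {r l : Fin N → ℝ}

theorem charFun_map_ergodicSum (ha : 0 < a) (f : Fin N → ℝ) (c t : ℝ) (k : ℕ) :
    charFun ((G.weightedDist k).map (fun x => G.ergodicSum f x / c) : Measure ℝ) t =
      ((fun i => (G.wInit i : ℂ) * Complex.exp ((t / c : ℝ) * f i * Complex.I)) ⬝ᵥ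
        (twistedMatrix (a⁻¹ • G.M) f (t / c) ^ k *ᵥ fun i => (G.wFinal i : ℂ))) /
          ((a⁻¹ ^ k * G.Z k : ℝ) : ℂ) := by
  have hM : twistedMatrix (a⁻¹ • G.M) f (t / c) = (a⁻¹ : ℂ) •
      of fun i j => (G.M i j : ℂ) * Complex.exp ((t / c : ℝ) * f j * Complex.I) := by
    ext i j
    simp only [twistedMatrix, of_apply, Matrix.smul_apply, smul_eq_mul]
    push_cast
    ring
  have ha' : (a⁻¹ : ℂ) ^ k ≠ 0 := pow_ne_zero _ (inv_ne_zero (by exact_mod_cast ha.ne'))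
  rw [charFun_apply_real, G.integral_map_weightedDist _ _
    (by fun_prop : Continuous _).stronglyMeasurable, hM, smul_pow, smul_mulVec, dotProduct_smul,
    ← sum_weight_mul_exp, smul_eq_mul]
  push_cast
  rw [mul_div_mul_left _ _ ha', Finset.sum_div]
  refine Finset.sum_congr rfl fun x _ => ?_
  rw [Complex.real_smul]
  push_cast
  rw [div_mul_eq_mul_div]
  congr 4
  ring

theorem tendsto_charFun_map_ergodicSum (ha : 0 < a) (hP : IsPerronData (a⁻¹ • G.M) r l)
    (hr : 0 < G.wInit ⬝ᵥ r) (hl : 0 < l ⬝ᵥ G.wFinal) {f : Fin N → ℝ} {σ : ℝ}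
    (hσ : ∀ (s : ℕ → ℝ) (τ : ℝ), Tendsto s atTop (𝓝 0) →
      Tendsto (fun n : ℕ => n * s n ^ 2) atTop (𝓝 τ) → ∀ w : Fin N → ℝ,
        Tendsto (fun n => twistedMatrix (a⁻¹ • G.M) f (s n) ^ n *ᵥ (fun i => (w i : ℂ))) atTop
          (𝓝 (fun i => Complex.exp (-(σ * τ / 2)) * ((l ⬝ᵥ w) * r i : ℝ)))) (t : ℝ) :
    Tendsto (fun k : ℕ => charFun ((G.weightedDist k).map
      (fun x => G.ergodicSum f x / Real.sqrt ((k : ℝ) + 1)) : Measure ℝ) t) atTop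
      (𝓝 (Complex.exp (-(σ * t ^ 2 / 2)))) := by
  set s : ℕ → ℝ := fun k => t / Real.sqrt ((k : ℝ) + 1) with hs_def
  have hs : Tendsto s atTop (𝓝 0) :=
    tendsto_const_nhds.div_atTop (Real.tendsto_sqrt_atTop.comp
      (tendsto_atTop_add_const_right _ _ tendsto_natCast_atTop_atTop))
  -- The power counts `n` edges, the normalization `n + 1` vertices; the ratio tends to `1`.
  have hsτ : Tendsto (fun n : ℕ => n * s n ^ 2) atTop (𝓝 (t ^ 2)) := by
    have h1 := (tendsto_natCast_div_add_atTop (1 : ℝ)).mul_const (t ^ 2)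
    rw [one_mul] at h1
    refine h1.congr fun n => ?_
    rw [hs_def]
    simp only
    rw [div_pow, Real.sq_sqrt (by positivity)]
    ring
  have hw := hσ s (t ^ 2) hs hsτ G.wFinal
  have hv : Tendsto (fun k i => (G.wInit i : ℂ) * Complex.exp (s k * f i * Complex.I)) atTop
      (𝓝 fun i => (G.wInit i : ℂ)) := by
    refine tendsto_pi_nhds.2 fun i => ?_
    have hc : Continuous fun x : ℝ => (G.wInit i : ℂ) * Complex.exp (x * f i * Complex.I) := by
      fun_prop
    simpa [Function.comp_def] using (hc.tendsto 0).comp hs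
  have hZ := (Complex.continuous_ofReal.tendsto _).comp (tendsto_inv_pow_mul_Z hP)
  have hZ0 : (((l ⬝ᵥ G.wFinal) * (G.wInit ⬝ᵥ r) : ℝ) : ℂ) ≠ 0 := by
    exact_mod_cast (mul_pos hl hr).ne'
  have hdot : Continuous fun p : (Fin N → ℂ) × (Fin N → ℂ) => p.1 ⬝ᵥ p.2 :=
    Continuous.dotProduct continuous_fst continuous_snd
  have hlim := ((hdot.tendsto _).comp (hv.prodMk_nhds hw)).div hZ hZ0
  have hval : ((fun i => (G.wInit i : ℂ)) ⬝ᵥ fun i =>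
      Complex.exp (-(σ * (t ^ 2 : ℝ) / 2)) * (((l ⬝ᵥ G.wFinal) * r i : ℝ) : ℂ)) /
        (((l ⬝ᵥ G.wFinal) * (G.wInit ⬝ᵥ r) : ℝ) : ℂ) = Complex.exp (-(σ * t ^ 2 / 2)) := by
    rw [div_eq_iff hZ0]
    simp only [dotProduct]
    push_cast
    simp only [Finset.mul_sum]
    exact Finset.sum_congr rfl fun i _ => by ring
  rw [← hval]
  refine hlim.congr fun k => ?_
  rw [charFun_map_ergodicSum ha]
  rfl

end CWG

theorem mainTheorem11 {N : ℕ} (G : CWG N)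
    (μ : ProbabilityMeasure G.PathSpace) (hμ : G.IsLimitWeightedMeasure μ)
    (π : Fin N → ℝ) (hπ : G.IsStationaryMeasure μ π)
    (f : Fin N → ℝ) (γ : ℝ) (hγ : γ = ∑ j, π j * f j) :
    ∃ σ2 : ℝ≥0,
      Tendsto
        (fun k : ℕ => (G.weightedDist k).map
          (fun x => (G.ergodicSum f x - ((k : ℝ) + 1) * γ) / Real.sqrt ((k : ℝ) + 1)))
        atTop (𝓝 (⟨gaussianReal 0 σ2, inferInstance⟩ : FiniteMeasure ℝ)) ∧
      (σ2 = 0 ↔ ∃ g : Fin N → ℝ, ∀ i j, 0 < G.M i j →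
        i ∈ Function.support π → j ∈ Function.support π → f i = γ + g i - g j) := by
  obtain ⟨a, r, l, ha, hP, hr, hl⟩ := G.exists_isPerronData
  have hπlr := CWG.stationary_eq ha hP hr hl hμ hπ
  set F : Fin N → ℝ := fun i => f i - γ with hF
  have hF0 : ∑ i, l i * r i * F i = 0 := by
    simp only [← hπlr, hF, mul_sub, Finset.sum_sub_distrib, ← Finset.sum_mul, hπ.2.1]
    rw [hγ, one_mul, sub_self]
  obtain ⟨σ, hσ0, hσ, hlim⟩ := hP.exists_variance hF0
  lift σ to ℝ≥0 using hσ0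
  refine ⟨σ, ?_, ?_⟩
  · have hchar := CWG.tendsto_charFun_map_ergodicSum ha hP hr hl hlim
    have hsum : ∀ (k : ℕ) (x : G.Path k),
        G.ergodicSum f x - ((k : ℝ) + 1) * γ = G.ergodicSum F x := by
      intro k x
      simp [CWG.ergodicSum, hF, Finset.sum_sub_distrib]
    simp only [hsum]
    have hZ : ∀ᶠ k in atTop, G.Z k ≠ 0 := by
      filter_upwards [(CWG.tendsto_inv_pow_mul_Z hP).eventually_ne (mul_pos hl hr).ne'] with k hk
      exact right_ne_zero_of_mul hk
    classical
    -- Lévy's theorem needs probability measures, but the law is zero when `Z_k = 0`; a Dirac mass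
    -- replaces it at those finitely many `k`.
    set ν : ℕ → ProbabilityMeasure ℝ := fun k =>
      if h : G.Z k ≠ 0 then
        ⟨((G.weightedDist k).map fun x => G.ergodicSum F x / Real.sqrt ((k : ℝ) + 1) :
          FiniteMeasure ℝ), G.isProbabilityMeasure_map_weightedDist h _⟩
      else ⟨Measure.dirac 0, inferInstance⟩ with hν
    have hνZ : ∀ k, G.Z k ≠ 0 → (ν k).toFiniteMeasure =
        (G.weightedDist k).map fun x => G.ergodicSum F x / Real.sqrt ((k : ℝ) + 1) := by
      intro k hk
      exact congrArg ProbabilityMeasure.toFiniteMeasure (dif_pos hk)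
    have hconv : Tendsto ν atTop (𝓝 ⟨gaussianReal 0 σ, inferInstance⟩) := by
      refine ProbabilityMeasure.tendsto_of_tendsto_charFun fun t => ?_
      have hg : charFun (gaussianReal 0 σ) t = Complex.exp (-(σ * t ^ 2 / 2)) := by
        rw [charFun_gaussianReal]
        congr 1
        simp
      change Tendsto _ _ (𝓝 (charFun (gaussianReal 0 σ) t))
      rw [hg]
      refine (hchar t).congr' ?_
      filter_upwards [hZ] with k hk
      rw [← hνZ k hk]
      rfl
    have hfin := (ProbabilityMeasure.tendsto_nhds_iff_toFiniteMeasure_tendsto_nhds atTop).1 hconv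
    refine Tendsto.congr' ?_ hfin
    filter_upwards [hZ] with k hk
    exact hνZ k hk
  · rw [← NNReal.coe_eq_zero, hσ]
    -- The left side asks only `l i > 0` and `r j > 0`; along an edge, positivity of `r` passes
    -- backwards and of `l` forwards, so both ends lie in the support of `π = l r`.
    have hpos : ∀ i j, 0 < l i * (a⁻¹ • G.M) i j * r j ↔
        0 < G.M i j ∧ i ∈ Function.support π ∧ j ∈ Function.support π := by
      intro i j
      simp only [Function.mem_support, hπlr]
      constructor
      · intro h
        have hlA := pos_of_mul_pos_left h (hP.right_nonneg j)
        have hrj := pos_of_mul_pos_right h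
          (mul_nonneg (hP.left_nonneg i) (hP.nonneg i j))
        have hli := pos_of_mul_pos_left hlA (hP.nonneg i j)
        have hA := pos_of_mul_pos_right hlA (hP.left_nonneg i)
        exact ⟨pos_of_mul_pos_right (a := a⁻¹) hA (inv_nonneg.2 ha.le),
          (mul_pos hli (hP.right_pos_of_pos hA hrj)).ne',
          (mul_pos (hP.left_pos_of_pos hA hli) hrj).ne'⟩
      · rintro ⟨hM, hi, hj⟩
        have hli := lt_of_le_of_ne (hP.left_nonneg i) (left_ne_zero_of_mul hi).symm
        have hrj := lt_of_le_of_ne (hP.right_nonneg j) (right_ne_zero_of_mul hj).symm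
        exact mul_pos (mul_pos hli (mul_pos (inv_pos.2 ha) hM)) hrj
    refine exists_congr fun g => forall_congr' fun i => forall_congr' fun j => ?_
    rw [hpos]
    constructor
    · intro h hM hi hj
      linarith [h ⟨hM, hi, hj⟩]
    · rintro h ⟨hM, hi, hj⟩
      linarith [h hM hi hj]
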